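/- Let $F_2$ be the free group on $a,b$. Put $S_{0ab}=S_{0ba}=\emptyset$ and, for $k\ge 1$, $$S_{kab}=S_{(k-1)ab}\cup a^{2^{k-1}}S_{(k-1)ab}\,a^{-2^{k-1}}\cup a^{2^{k-1}}\big(\{b^{2^{k-1}}\}\cup S_{(k-1)ba}\big)a^{-2^{k-1}},$$ $$S_{kba}=S_{(k-1)ba}\cup b^{2^{k-1}}S_{(k-1)ba}\,b^{-2^{k-1}}\cup b^{2^{k-1}}\big(\{a^{2^{k-1}}\}\cup S_{(k-1)ab}\big)b^{-2^{k-1}}.$$ For $k\ge 0$ let $G_k=\langle a^{2^k},b^{2^k},S_{kab},S_{kba}\rangle\le F_2$; then $G_{k+1}\le G_k$. Let $\Lambda_k$ be the Schreier graph of $F_2/G_k$, regarded as a topological space (a one-dimensional complex): its vertices are the cosets $[g]=G_kg$, and for each vertex $G_kg$ and each $s\in\{a,b\}$ there is one edge, labelled $s$, from $G_kg$ to $G_kgs$. Let $\nu^{k+1}_k:\Lambda_{k+1}\to\Lambda_k$ be the map induced by $G_{k+1}g\mapsto G_kg$, preserving the labels and the parametrization of edges. The (simplified) Schreier continuum of the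 Schori solenoid is $\Lambda=\varprojlim\{\Lambda_k,\nu^{k+1}_k,k\ge 0\}$. A vertex of $\Lambda$ is a point $v=(v_k)$ all of whose coordinates $v_k$ are vertices. Its path component in $\Lambda$ is denoted $L_v$ and carries the leaf topology, that is, the topology induced from the one on $\Lambda$ generated by the path components of open subsets of $\Lambda$ (so that $L_v$ is a graph). Write $\mathrm{id}_k=[1]$ and let $a^i$, $b^i$ also denote the vertices $[a^i]$, $[b^i]$ of $\Lambda_k$. For $k\ge1$ let $\mathcal A_k$ (resp. $\mathcal B_k$) be the connected component of $\Lambda_k\setminus\{\mathrm{id}_k\}$ containing the vertices $a^i$ (resp. $b^i$), $0<i<2^k$. Let $\mathcal{TA}_k$ be what remains of $\mathcal A_k\setminus\{a^{2^{k-1}}\}$ after removing the components that contain a vertex $a^i$ with $0<i<2^{k-1}$ or $2^{k-1}<i<2^k$ (for $k\ge 2$ it is a single component), and define $\mathcal{TB}_k\subset\mathcal B_k\setminus\{b^{2^{k-1}}\}$ in the same way with $b$ in place of $a$. A vertex $v=(v_k)$ of $\Lambda$ is called flip-flopping if there is a cofinal set $I\subset\mathbb N_0$ with cofinal complement $\mathbb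 N_0\setminus I$ such that $v_k\in\mathcal{TA}_k\cup\mathcal{TB}_k$ for every $k\in I$ (with $\mathcal{TA}_0=\mathcal{TB}_0=\emptyset$); in particular this holds whenever the coordinates of $v$ lie cofinally but not eventually in $\mathcal{TA}_k\cup\mathcal{TB}_k$. The ends of a space $X$ are computed from an exhaustion $K_0\subset K_1\subset\cdots$ of $X$ by compact sets with $K_i\subset\operatorname{int}K_{i+1}$ and $\bigcup_i K_i=X$: an end is an equivalence class of chains $U_0\supset U_1\supset\cdots$ with $\bigcap_i U_i=\emptyset$, where each $U_i$ is an unbounded connected component of $X\setminus K_i$ (one whose closure is not compact), and $\{U_i\}\sim\{V_i\}$ if for every $i$ there is $j>i$ with $U_j\cup V_j\subset U_i\cap V_i$. **Lemma.** If $v\in\Lambda$ is a flip-flopping vertex, then $L_v$ has exactly $1$ end. (That is, $L_v$ admits an exhaustion as above, and for every such exhaustion there is exactly one end.) -/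

import Mathlib

open Set Topology Filter

/-! ### Ends of a topological space -/

section Ends

variable {X : Type*} [TopologicalSpace X]

/-- A chain of unbounded complementary components with respect to a compact exhaustion `K` of `X`:
a decreasing sequence of sets `U i`, each a connected component of the complement of `K i` which is
unbounded (its closure is not compact), with empty intersection. -/
structure EndChain (K : CompactExhaustion X) where
  U : ℕ → Set X
  isComponent : ∀ i, ∃ x ∈ (K i)ᶜ, U i = connectedComponentIn (K i)ᶜ x
  unbounded : ∀ i, ¬ IsCompact (closure (U i))
  antitone : Antitone U
  iInter_eq : ⋂ i, U i = ∅

/-- Equivalence of chains: for every `i` there is `j > i` with `U j ∪ V j ⊆ U i ∩ V i`. -/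
instance EndChain.setoid (K : CompactExhaustion X) : Setoid (EndChain K) where
  r C D := ∀ i, ∃ j > i, C.U j ∪ D.U j ⊆ C.U i ∩ D.U i
  iseqv :=
    { refl := fun C i => ⟨i + 1, Nat.lt_succ_self i, by
        simpa using C.antitone (Nat.le_succ i)⟩
      symm := fun {C D} h i => by
        obtain ⟨j, hj, hs⟩ := h i
        exact ⟨j, hj, by rwa [union_comm, inter_comm]⟩
      trans := fun {C D E} h h' i => by
        obtain ⟨j, hj, hs⟩ := h i
        obtain ⟨k, hk, ht⟩ := h' i
        obtain ⟨j', hj', hs'⟩ := h k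
        obtain ⟨k', hk', ht'⟩ := h' j
        refine ⟨max j' k', by omega, ?_⟩
        have hC : C.U (max j' k') ⊆ C.U j' := C.antitone (le_max_left _ _)
        have hE : E.U (max j' k') ⊆ E.U k' := E.antitone (le_max_right _ _)
        intro x hx
        rcases hx with hx | hx
        · have hx' := hC hx
          have hD : x ∈ D.U k := (hs' (Or.inl hx')).2
          refine ⟨C.antitone (by omega : i ≤ j') hx', ?_⟩
          exact (ht (Or.inl hD)).2
        · have hx' := hE hx
          have hD : x ∈ D.U j := (ht' (Or.inr hx')).1
          exact ⟨(hs (Or.inr hD)).1, E.antitone (by omega : i ≤ k') hx'⟩ }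

/-- The set of ends of `X`, computed with the compact exhaustion `K`. -/
def SpaceOfEnds (K : CompactExhaustion X) : Type _ := Quotient (EndChain.setoid K)

variable (X) in
/-- `X` has exactly `n` ends: `X` has a compact exhaustion, and for each of its compact exhaustions
the set of ends has `n` elements. -/
def HasNumEnds (n : ℕ∞) : Prop :=
  Nonempty (CompactExhaustion X) ∧ ∀ K : CompactExhaustion X, ENat.card (SpaceOfEnds K) = n

/-- The leaf topology on `X`: the open sets are generated by the path components of the
open subsets of `X`. -/
abbrev leafTopology (X : Type*) [TopologicalSpace X] : TopologicalSpace X :=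
  TopologicalSpace.generateFrom {P | ∃ O : Set X, IsOpen O ∧ ∃ x ∈ O, P = pathComponentIn O x}

end Ends

namespace Schori

/-! ### The group chain -/

/-- The free group of rank two; its free generators are indexed by the two letters
`true` (for `a`) and `false` (for `b`). -/
abbrev F₂ : Type := FreeGroup Bool

/-- The free generator with letter `s`: `gen true = a` and `gen false = b`. -/
def gen (s : Bool) : F₂ := FreeGroup.of s

/-- `sideGens true k` is the set `S_{kab}` and `sideGens false k` is the set `S_{kba}`:
both are empty for `k = 0`, and, with `x` the generator with letter `s`, `y` the other one and
`c = x ^ (2 ^ k)`, the set for `s` and `k + 1` is `S ∪ c S c⁻¹ ∪ c ({y ^ (2 ^ k)} ∪ T) c⁻¹`, where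
`S` and `T` are the sets at stage `k` for `s` and for the other letter. -/
def sideGens : Bool → ℕ → Set F₂
  | _, 0 => ∅
  | s, k + 1 =>
      sideGens s k ∪
      (fun g => gen s ^ 2 ^ k * g * (gen s ^ 2 ^ k)⁻¹) '' sideGens s k ∪
      (fun g => gen s ^ 2 ^ k * g * (gen s ^ 2 ^ k)⁻¹) ''
        ({gen (!s) ^ 2 ^ k} ∪ sideGens (!s) k)

/-- The subgroup `G_k` of the free group, generated by
`a ^ (2 ^ k)`, `b ^ (2 ^ k)`, `S_{kab}` and `S_{kba}`. -/
def G (k : ℕ) : Subgroup F₂ :=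
  Subgroup.closure
    ({gen true ^ 2 ^ k} ∪ {gen false ^ 2 ^ k} ∪ sideGens true k ∪ sideGens false k)

theorem gen_pow_mem (s : Bool) (k : ℕ) : gen s ^ 2 ^ k ∈ G k := by
  apply Subgroup.subset_closure
  cases s <;> simp

theorem sideGens_subset (s : Bool) (k : ℕ) : sideGens s k ⊆ G k := by
  intro g hg
  apply Subgroup.subset_closure
  cases s <;> simp [hg]

theorem sideGens_succ_subset (s : Bool) (k : ℕ) : sideGens s (k + 1) ⊆ G k := by
  have hc := gen_pow_mem s k
  rintro g ((hg | ⟨h, hh, rfl⟩) | ⟨h, hh, rfl⟩)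
  · exact sideGens_subset s k hg
  · exact (G k).mul_mem ((G k).mul_mem hc (sideGens_subset s k hh)) ((G k).inv_mem hc)
  · refine (G k).mul_mem ((G k).mul_mem hc ?_) ((G k).inv_mem hc)
    rcases hh with hh | hh
    · rw [mem_singleton_iff.1 hh]
      exact gen_pow_mem _ k
    · exact sideGens_subset _ k hh

/-- The subgroups form a decreasing chain. -/
theorem G_succ_le (k : ℕ) : G (k + 1) ≤ G k := by
  have hp : ∀ s, gen s ^ 2 ^ (k + 1) ∈ G k := fun s => by
    rw [pow_succ, pow_mul]
    exact (G k).pow_mem (gen_pow_mem s k) 2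
  refine (Subgroup.closure_le _).2 ?_
  rintro g (((hg | hg) | hg) | hg)
  · rw [mem_singleton_iff.1 hg]
    exact hp true
  · rw [mem_singleton_iff.1 hg]
    exact hp false
  · exact sideGens_succ_subset _ k hg
  · exact sideGens_succ_subset _ k hg

/-! ### The Schreier graphs and their inverse limit -/

/-- The vertices of the `k`-th Schreier graph: the cosets `G_k g`, with the discrete topology. -/
def Coset (k : ℕ) : Type := Quotient (QuotientGroup.rightRel (G k))

instance (k : ℕ) : TopologicalSpace (Coset k) := ⊥

instance (k : ℕ) : DiscreteTopology (Coset k) := ⟨rfl⟩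

/-- The coset `[g] = G_k g`. -/
def coset (k : ℕ) (g : F₂) : Coset k := Quotient.mk (QuotientGroup.rightRel (G k)) g

/-- The other end `G_k g x` of the edge labelled by the generator `x` (with letter `s`) that starts
at `G_k g`. -/
def Coset.step {k : ℕ} (w : Coset k) (s : Bool) : Coset k :=
  Quotient.map (sa := QuotientGroup.rightRel (G k)) (sb := QuotientGroup.rightRel (G k))
    (fun g => g * gen s) (fun g h hgh => by
      have hgh' := QuotientGroup.rightRel_apply.1 hgh
      exact QuotientGroup.rightRel_apply.2 (by simpa [mul_assoc] using hgh')) w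

/-- The projection `G_{k+1} g ↦ G_k g`. -/
def Coset.proj {k : ℕ} (w : Coset (k + 1)) : Coset k :=
  Quotient.map (sa := QuotientGroup.rightRel (G (k + 1))) (sb := QuotientGroup.rightRel (G k))
    id (fun _ _ hgh =>
      QuotientGroup.rightRel_apply.2 (G_succ_le k (QuotientGroup.rightRel_apply.1 hgh))) w

theorem Coset.step_coset (k : ℕ) (g : F₂) (s : Bool) :
    (coset k g).step s = coset k (g * gen s) := rfl

theorem Coset.proj_coset (k : ℕ) (g : F₂) : (coset (k + 1) g).proj = coset k g := rfl

theorem Coset.proj_step {k : ℕ} (w : Coset (k + 1)) (s : Bool) :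
    (w.step s).proj = w.proj.step s := by
  obtain ⟨g, rfl⟩ : ∃ g, coset (k + 1) g = w := Quotient.exists_rep w
  rw [Coset.step_coset, Coset.proj_coset, Coset.proj_coset, Coset.step_coset]

/-- Vertices together with disjoint parametrized edges `[0, 1]`, one for every vertex and
letter. -/
abbrev Pieces (k : ℕ) : Type := Coset k ⊕ (Coset k × Bool × unitInterval)

/-- The gluing relation: the edge `(w, s)` runs from the vertex `w` to the vertex `w.step s`. -/
inductive Glue (k : ℕ) : Pieces k → Pieces k → Prop
  | source (w : Coset k) (s : Bool) : Glue k (Sum.inr (w, s, 0)) (Sum.inl w)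
  | target (w : Coset k) (s : Bool) : Glue k (Sum.inr (w, s, 1)) (Sum.inl (w.step s))

/-- The `k`-th Schreier graph `Λ_k` of the cosets of `G_k` with respect to the generators `a`, `b`,
as a topological space (a one-dimensional complex; an edge traversed backwards is the edge labelled
by the inverse letter). -/
def Graph (k : ℕ) : Type := Quot (Glue k)

instance (k : ℕ) : TopologicalSpace (Graph k) :=
  inferInstanceAs (TopologicalSpace (Quot (Glue k)))

/-- The vertex `w` as a point of the graph. -/
def vertex {k : ℕ} (w : Coset k) : Graph k := Quot.mk _ (Sum.inl w)

/-- The bonding map `Λ_{k+1} → Λ_k`: the coset projection on vertices, and the label and parameter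
preserving map on edges. -/
def bond (k : ℕ) : Graph (k + 1) → Graph k :=
  Quot.map (Sum.map Coset.proj (fun e => (e.1.proj, e.2.1, e.2.2))) (by
    rintro _ _ (⟨w, s⟩ | ⟨w, s⟩)
    · exact Glue.source _ _
    · simp only [Sum.map_inr, Sum.map_inl, Coset.proj_step]
      exact Glue.target _ _)

/-- The Schreier continuum: the inverse limit of the graphs `Λ_k`, with the topology
induced from the product. -/
def Continuum : Type := {x : ∀ k, Graph k // ∀ k, bond k (x (k + 1)) = x k}

instance : TopologicalSpace Continuum :=
  inferInstanceAs (TopologicalSpace {x : ∀ k, Graph k // ∀ k, bond k (x (k + 1)) = x k})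

/-- A point of the continuum is a vertex if all its coordinates are vertices. -/
def IsVertex (v : Continuum) : Prop := ∀ k, v.1 k ∈ range (vertex (k := k))

/-- The path component `L_v` of `v` in the Schreier continuum. -/
def Leaf (v : Continuum) : Type := pathComponent v

/-- `L_v` carries the leaf topology. -/
instance (v : Continuum) : TopologicalSpace (Leaf v) :=
  @instTopologicalSpaceSubtype Continuum (· ∈ pathComponent v) (leafTopology Continuum)

/-! ### Flip-flopping points -/

/-- `idPt k` is the vertex `id_k` of the trivial coset. -/
def idPt (k : ℕ) : Graph k := vertex (coset k 1)

/-- `powPt s k i` is the vertex `a ^ i` (for `s = true`) or `b ^ i` (for `s = false`) of `Λ_k`. -/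
def powPt (s : Bool) (k i : ℕ) : Graph k := vertex (coset k (gen s ^ i))

/-- The component of `Λ_k ∖ {id_k}` containing the vertices `x ^ i`, `0 < i < 2 ^ k`: this is
`𝒜_k` for `x = a` (`s = true`) and `ℬ_k` for `x = b` (`s = false`). (There are no such vertices
for `k = 0`, and the set is then empty.) -/
def arm (s : Bool) (k : ℕ) : Set (Graph k) := connectedComponentIn {idPt k}ᶜ (powPt s k 1)

/-- The components of `𝒜_{k+1} ∖ {a ^ (2 ^ k)}` (or of `ℬ_{k+1} ∖ {b ^ (2 ^ k)}`) that
contain a vertex `x ^ i` with `0 < i < 2 ^ k`; for `k ≥ 1` there is just one, called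
`𝒜⁺_{k+1}` (or `ℬ⁺_{k+1}`). -/
def armPlus (s : Bool) (k : ℕ) : Set (Graph (k + 1)) :=
  ⋃ i ∈ Ioo 0 (2 ^ k),
    connectedComponentIn (arm s (k + 1) \ {powPt s (k + 1) (2 ^ k)}) (powPt s (k + 1) i)

/-- The same with `2 ^ k < i < 2 ^ (k + 1)`: the component `𝒜⁻_{k+1}` (or `ℬ⁻_{k+1}`). -/
def armMinus (s : Bool) (k : ℕ) : Set (Graph (k + 1)) :=
  ⋃ i ∈ Ioo (2 ^ k) (2 ^ (k + 1)),
    connectedComponentIn (arm s (k + 1) \ {powPt s (k + 1) (2 ^ k)}) (powPt s (k + 1) i)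

/-- The remaining component of `𝒜_{k+1} ∖ {a ^ (2 ^ k)}`, called `𝒯𝒜_{k+1}`, for `s = true`, and
the remaining component of `ℬ_{k+1} ∖ {b ^ (2 ^ k)}`, called `𝒯ℬ_{k+1}`, for `s = false`. (For
`k = 0` what remains contains no vertex.) It is only defined in positive degree. -/
def side (s : Bool) : (k : ℕ) → Set (Graph k)
  | 0 => ∅
  | k + 1 => (arm s (k + 1) \ {powPt s (k + 1) (2 ^ k)}) \ (armPlus s k ∪ armMinus s k)

/-- A flip-flopping point: there is a cofinal set `I` of indices with cofinal complement such
that `v_k ∈ 𝒯𝒜_k ∪ 𝒯ℬ_k` for all `k ∈ I`. -/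
def IsFlipFlopping (v : Continuum) : Prop :=
  ∃ I : Set ℕ, (∀ n, ∃ k ∈ I, n ≤ k) ∧ (∀ n, ∃ k ∈ Iᶜ, n ≤ k) ∧
    ∀ k ∈ I, v.1 k ∈ side true k ∪ side false k

end Schori

/-! The vertices of `Graph k` are named by words of length `k` in the digits 0, a, b, least
significant digit first. The generator `s` acts as an odometer that exchanges 0 and `s` and carries
when `s` returns to 0. The power `gen s ^ 2 ^ k` turns the odometer at digit `k` when the first `k`
digits vanish, and from this `G k` fixes the zero word. Conversely, the Schreier generators of the
transversal `tau` lie in `G k` (`schreier_generators`), so `G k` is exactly the stabilizer of the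
zero word (`mem_G_iff`) and `code` is injective.

In these names the component `arm s k` has as vertices the words whose most significant nonzero
digit is `s`. A vertex of `side s (n + 1)` has last digit `s`, while the nonzero digit before it is
the other letter (`code_of_mem_side`). Hence a flip-flopping vertex satisfies `FlipsAt x n s` for
arbitrarily large `n`.

Fix such an `n` and vary only the first `n` digits of `x`, keeping their top nonzero digit equal to
`!s`. The only exit from this set of vertices makes all `n` digits zero. A step that does so uses
the generator `!s`, and its carry is absorbed by digit `n`, which is `s`. So every exit passes
through the single vertex `root x n` (`FlipsAt.isCut`). The corresponding lobe of the leaf is open,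
its closure lies in finitely many edges, and its frontier is at most that one vertex. Successive
lobes are nested and exhaust the leaf (`iUnion_lobe`).

In a connected space, an open set with at most one frontier point, the point lying outside it, has
connected complement. An exhaustion by relatively compact sets of this kind leaves exactly one end
(`hasNumEnds_one_of_frontier_subset`). -/

/-! ### A criterion for having one end -/

section OneEnd

variable {X : Type*} [TopologicalSpace X]

/-- If an open set `T` of a connected space has at most one frontier point, then its complement is
connected, as a retract of the space. -/
theorem isPreconnected_compl_of_frontier_subset [PreconnectedSpace X] {T : Set X} {c : X}
    (hfr : frontier T ⊆ {c}) (hc : c ∉ T) : IsPreconnected Tᶜ := by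
  classical
  have hcont : Continuous (fun x => if x ∈ T then c else x) := by
    refine Continuous.if (fun a ha => ?_) continuous_const continuous_id
    exact (hfr ha).symm
  have hrange : range (fun x => if x ∈ T then c else x) = Tᶜ := by
    ext y
    constructor
    · rintro ⟨x, rfl⟩
      by_cases hx : x ∈ T <;> simp [hx, hc]
    · intro hy
      exact ⟨y, if_neg hy⟩
  rw [← hrange]
  exact isPreconnected_range hcont

/-- Once `T n` contains the compact set `K i`, the connected complement of `T n` lies in one
component of the complement of `K i`. Every other component is trapped in `T n`, so it is bounded.
-/
theorem hasNumEnds_one_of_frontier_subset [PreconnectedSpace X] (T : ℕ → Set X) (c : ℕ → X)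
    (hopen : ∀ n, IsOpen (T n)) (hcomp : ∀ n, IsCompact (closure (T n)))
    (hsub : ∀ n, closure (T n) ⊆ T (n + 1)) (hU : ⋃ n, T n = univ)
    (hfr : ∀ n, frontier (T n) ⊆ {c n}) (hc : ∀ n, c n ∉ T n) : HasNumEnds X 1 := by
  have hmono : Monotone T := monotone_nat_of_le_succ fun n => subset_closure.trans (hsub n)
  have hdir : Directed (· ⊆ ·) T := hmono.directed_le
  have habs : ∀ {C : Set X}, IsCompact C → ∃ n, C ⊆ T n := fun hC =>
    hC.elim_directed_cover T hopen (by rw [hU]; exact subset_univ _) hdir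
  have hnc : ¬ IsCompact (univ : Set X) := fun h => by
    obtain ⟨n, hn⟩ := habs h
    exact hc n (hn (mem_univ _))
  refine ⟨⟨⟨fun n => closure (T n), hcomp, fun n => ?_, ?_⟩⟩, fun K => ?_⟩
  · exact (hsub n).trans (interior_maximal subset_closure (hopen _))
  · rw [eq_univ_iff_forall]
    intro x
    obtain ⟨n, hn⟩ := mem_iUnion.1 (hU.ge (mem_univ x))
    exact mem_iUnion.2 ⟨n, subset_closure hn⟩
  choose N hN using fun i => habs (K.isCompact i)
  have hcK : ∀ i, c (N i) ∈ (K i)ᶜ := fun i h => hc _ (hN i h)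
  let U : ℕ → Set X := fun i => connectedComponentIn (K i)ᶜ (c (N i))
  have hsubU : ∀ i, (T (N i))ᶜ ⊆ U i := fun i =>
    (isPreconnected_compl_of_frontier_subset (hfr _) (hc _)).subset_connectedComponentIn
      (hc _) (compl_subset_compl.2 (hN i))
  -- a component with noncompact closure is the distinguished one
  have huniq : ∀ i x, ¬ IsCompact (closure (connectedComponentIn (K i)ᶜ x)) →
      connectedComponentIn (K i)ᶜ x = U i := by
    intro i x hx
    have hne : ¬ connectedComponentIn (K i)ᶜ x ⊆ T (N i) := fun h =>
      hx ((hcomp (N i)).of_isClosed_subset isClosed_closure (closure_mono h))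
    obtain ⟨y, hy, hyT⟩ := not_subset.1 hne
    exact (connectedComponentIn_eq hy).trans (connectedComponentIn_eq (hsubU i hyT)).symm
  have hcof : ∀ i, ¬ IsCompact (closure (U i)) := fun i h => hnc <| by
    refine ((hcomp (N i)).union h).of_isClosed_subset isClosed_univ fun x _ => ?_
    by_cases hx : x ∈ T (N i)
    · exact Or.inl (subset_closure hx)
    · exact Or.inr (subset_closure (hsubU i hx))
  have hanti : Antitone U := by
    intro i j hij
    have hKij : (K j)ᶜ ⊆ (K i)ᶜ := compl_subset_compl.2 (K.subset hij)
    -- The base points of `U i` and `U j` differ, but the component of `(K i)ᶜ` around `c (N j)`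
    -- contains the unbounded `U j`, so `huniq` identifies it with `U i`.
    have hle : U j ⊆ connectedComponentIn (K i)ᶜ (c (N j)) :=
      connectedComponentIn_mono _ hKij
    have := huniq i (c (N j)) fun h =>
      hcof j (h.of_isClosed_subset isClosed_closure (closure_mono hle))
    exact hle.trans this.subset
  have hempty : ⋂ i, U i = ∅ := by
    refine eq_empty_iff_forall_notMem.2 fun x hx => ?_
    obtain ⟨i, hi⟩ := K.exists_mem x
    exact connectedComponentIn_subset _ _ (mem_iInter.1 hx i) hi
  let C₀ : EndChain K := ⟨U, fun i => ⟨_, hcK i, rfl⟩, hcof, hanti, hempty⟩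
  have hall : ∀ C : EndChain K, C.U = U := fun C => funext fun i => by
    obtain ⟨x, -, hx⟩ := C.isComponent i
    rw [hx]
    exact huniq i x (hx ▸ C.unbounded i)
  rw [ENat.card_eq_one_iff_unique]
  have : Subsingleton (SpaceOfEnds K) := by
    refine ⟨fun e e' => ?_⟩
    induction e using Quotient.inductionOn with | _ C => ?_
    induction e' using Quotient.inductionOn with | _ D => ?_
    refine Quotient.sound fun i => ⟨i + 1, Nat.lt_succ_self i, ?_⟩
    rw [hall C, hall D, union_self, inter_self]
    exact hanti (Nat.le_succ i)
  exact ⟨Unique.mk' _ (h₁ := ⟨Quotient.mk _ C₀⟩)⟩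

end OneEnd

namespace Schori

/-! ### The action of the free group on words -/

/-- Digits: `none` plays the role of zero, and there is one nonzero digit for each letter. -/
abbrev Digit : Type := Option Bool

/-- The odometer with letter `s`, on words with the least significant digit first: it interchanges
the digits `none` and `some s`, carrying over after the latter. -/
def act (s : Bool) : List Digit → List Digit
  | [] => []
  | none :: l => some s :: l
  | some t :: l => if t = s then none :: act s l else some t :: l

/-- The inverse of `act s`. -/
def actInv (s : Bool) : List Digit → List Digit
  | [] => []
  | none :: l => some s :: actInv s l
  | some t :: l => if t = s then none :: l else some t :: l

theorem act_actInv (s : Bool) (l : List Digit) : act s (actInv s l) = l := by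
  induction l with
  | nil => rfl
  | cons e l ih =>
    rcases e with _ | t
    · simp [act, actInv, ih]
    · by_cases h : t = s <;> simp [act, actInv, h]

theorem actInv_act (s : Bool) (l : List Digit) : actInv s (act s l) = l := by
  induction l with
  | nil => rfl
  | cons e l ih =>
    rcases e with _ | t
    · simp [act, actInv]
    · by_cases h : t = s <;> simp [act, actInv, h, ih]

/-- `act s` as a permutation. -/
def actPerm (s : Bool) : Equiv.Perm (List Digit) :=
  ⟨act s, actInv s, actInv_act s, act_actInv s⟩

/-- The right action of the free group on words for which the generators act by `act`. -/
def ract (g : F₂) (w : List Digit) : List Digit :=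
  -- Inverting both the generators and the result turns the left action of permutations into a right
  -- action.
  (FreeGroup.lift (fun s => (actPerm s)⁻¹) g)⁻¹ w

theorem ract_one (w : List Digit) : ract 1 w = w := by simp [ract]

theorem ract_mul (g h : F₂) (w : List Digit) : ract (g * h) w = ract h (ract g w) := by
  simp [ract]

theorem ract_gen (s : Bool) (w : List Digit) : ract (gen s) w = act s w := by
  simp [ract, gen, actPerm]

theorem ract_inv_ract (g : F₂) (w : List Digit) : ract g⁻¹ (ract g w) = w := by
  rw [← ract_mul, mul_inv_cancel, ract_one]

theorem ract_ract_inv (g : F₂) (w : List Digit) : ract g (ract g⁻¹ w) = w := by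
  rw [← ract_mul, inv_mul_cancel, ract_one]

theorem ract_inv_eq {g : F₂} {w w' : List Digit} (h : ract g w = w') : ract g⁻¹ w' = w := by
  rw [← h, ract_inv_ract]

/-- Induction on elements of the free group of rank two, from generators to inverses and
products. -/
theorem free_induction {P : F₂ → Prop} (one : P 1) (of : ∀ s, P (gen s))
    (inv : ∀ g, P g → P g⁻¹) (mul : ∀ g h, P g → P h → P (g * h)) (g : F₂) : P g :=
  FreeGroup.induction_on g one of (fun _ => inv _) mul

theorem length_act (s : Bool) (w : List Digit) : (act s w).length = w.length := by
  induction w with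
  | nil => rfl
  | cons e l ih =>
    rcases e with _ | t
    · simp [act]
    · by_cases h : t = s <;> simp [act, h, ih]

theorem take_act (s : Bool) (n : ℕ) (w : List Digit) : (act s w).take n = act s (w.take n) := by
  induction w generalizing n with
  | nil => simp [act]
  | cons e l ih =>
    cases n with
    | zero => simp [act]
    | succ n =>
      rcases e with _ | t
      · simp [act]
      · by_cases h : t = s <;> simp [act, h, ih]

theorem length_ract (g : F₂) (w : List Digit) : (ract g w).length = w.length := by
  induction g using free_induction generalizing w with
  | one => rw [ract_one]
  | of s => rw [ract_gen, length_act]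
  | inv g ih => rw [← ih, ract_ract_inv]
  | mul g h ihg ihh => rw [ract_mul, ihh, ihg]

theorem take_ract (g : F₂) (n : ℕ) (w : List Digit) :
    (ract g w).take n = ract g (w.take n) := by
  induction g using free_induction generalizing w with
  | one => rw [ract_one, ract_one]
  | of s => rw [ract_gen, ract_gen, take_act]
  | inv g ih =>
    have := ih (ract g⁻¹ w)
    rw [ract_ract_inv] at this
    exact (ract_inv_eq this.symm).symm
  | mul g h ihg ihh => rw [ract_mul, ihh, ihg, ract_mul]

/-- The zero word of length `k`. -/
abbrev zeros (k : ℕ) : List Digit := List.replicate k none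

/-- A carry leaves the prefix exactly when every digit of the prefix has been reset to zero. -/
theorem act_append (s : Bool) (p q : List Digit) :
    act s (p ++ q) = act s p ++ if act s p = zeros p.length then act s q else q := by
  induction p with
  | nil => simp [act]
  | cons e l ih =>
    rcases e with _ | t
    · simp [act, List.replicate_succ]
    · by_cases h : t = s
      · simp [act, h, ih, List.replicate_succ]
      · simp [act, h, List.replicate_succ]

/-- Doubling the exponent turns the odometer at digit `k` twice: a zero there becomes `s`, then zero
again with a carry. -/
theorem ract_gen_pow (s : Bool) (k : ℕ) (y : List Digit) :
    ract (gen s ^ 2 ^ k) (zeros k ++ y) = zeros k ++ act s y := by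
  induction k generalizing y with
  | zero => simp [ract_gen]
  | succ k ih =>
    rw [pow_succ, mul_two, pow_add, ract_mul, zeros, List.replicate_succ', List.append_assoc, ih,
      ih]
    simp [act]

theorem ract_sideGens (s : Bool) (k : ℕ) {g : F₂} (hg : g ∈ sideGens s k) (y : List Digit) :
    ract g (zeros k ++ y) = zeros k ++ y := by
  induction k generalizing s g y with
  | zero => exact hg.elim
  | succ k ih =>
    have hz : ∀ y, zeros (k + 1) ++ y = zeros k ++ (none :: y) := fun y => by
      rw [zeros, List.replicate_succ', List.append_assoc]; rfl
    -- Conjugation by `gen s ^ 2 ^ k` moves digit `k` from zero to `s`, where elements of stage `k`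
    -- act trivially and the power of the other generator meets a foreign digit that absorbs it.
    have hconj : ∀ h, ract h (zeros k ++ (some s :: y)) = zeros k ++ (some s :: y) →
        ract (gen s ^ 2 ^ k * h * (gen s ^ 2 ^ k)⁻¹) (zeros k ++ (none :: y)) =
          zeros k ++ (none :: y) := by
      intro h hh
      have h1 : ract (gen s ^ 2 ^ k) (zeros k ++ (none :: y)) = zeros k ++ (some s :: y) :=
        ract_gen_pow s k _
      rw [ract_mul, ract_mul, h1, hh, ract_inv_eq h1]
    rw [hz]
    rcases hg with (hg | ⟨h, hh, rfl⟩) | ⟨h, hh | hh, rfl⟩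
    · exact ih s hg _
    · exact hconj h (ih s hh _)
    · rw [mem_singleton_iff.1 hh]
      refine hconj _ ?_
      rw [ract_gen_pow]
      simp [act]
    · exact hconj h (ih _ hh _)

/-- The group `G k` fixes the zero word of length `k`. -/
theorem ract_zeros_of_mem {k : ℕ} {g : F₂} (hg : g ∈ G k) : ract g (zeros k) = zeros k := by
  induction hg using Subgroup.closure_induction with
  | mem g hg =>
    rcases hg with ((hg | hg) | hg) | hg
    · rw [mem_singleton_iff.1 hg]
      simpa [act] using ract_gen_pow true k []
    · rw [mem_singleton_iff.1 hg]
      simpa [act] using ract_gen_pow false k []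
    · simpa using ract_sideGens true k hg []
    · simpa using ract_sideGens false k hg []
  | one => exact ract_one _
  | mul g h _ _ ihg ihh => rw [ract_mul, ihg, ihh]
  | inv g _ ih => exact ract_inv_eq ih

/-! ### The most significant nonzero digit -/

/-- The most significant nonzero digit of a word (`none` for the zero words). -/
def topDigit : List Digit → Digit
  | [] => none
  | e :: l => (topDigit l).or e

theorem topDigit_append (p q : List Digit) :
    topDigit (p ++ q) = (topDigit q).or (topDigit p) := by
  induction p with
  | nil => simp [topDigit]
  | cons e l ih => simp [topDigit, ih, Option.or_assoc]

theorem topDigit_zeros (k : ℕ) : topDigit (zeros k) = none := by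
  induction k with
  | zero => rfl
  | succ k ih => simp [List.replicate_succ, topDigit, ih]

theorem eq_zeros_of_topDigit {w : List Digit} (h : topDigit w = none) : w = zeros w.length := by
  induction w with
  | nil => rfl
  | cons e l ih =>
    simp only [topDigit, Option.or_eq_none_iff] at h
    rw [h.2]
    exact congrArg (none :: ·) (ih h.1)

theorem topDigit_act_zeros (s : Bool) {k : ℕ} (hk : 0 < k) :
    topDigit (act s (zeros k)) = some s := by
  obtain ⟨k, rfl⟩ := Nat.exists_eq_succ_of_ne_zero hk.ne'
  simp [List.replicate_succ, act, topDigit, topDigit_zeros]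

/-- The top digit can change only by passing through the zero word. This is what makes the identity
coset a cut vertex. -/
theorem topDigit_act (s : Bool) (w : List Digit) (h : topDigit w ≠ none)
    (h' : topDigit (act s w) ≠ none) : topDigit (act s w) = topDigit w := by
  induction w with
  | nil => rfl
  | cons e l ih =>
    rcases e with _ | t
    · simp only [topDigit, Option.or_none] at h
      obtain ⟨x, hx⟩ := Option.ne_none_iff_exists'.1 h
      simp [act, topDigit, hx]
    · by_cases hts : t = s
      · subst hts
        simp only [act, if_true, topDigit, Option.or_none] at h' ⊢
        by_cases hl : topDigit l = none
        · rw [hl, eq_zeros_of_topDigit hl]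
          rcases Nat.eq_zero_or_pos l.length with h0 | h0
          · rw [List.length_eq_zero_iff.1 h0] at h'
            exact absurd rfl h'
          · simpa using topDigit_act_zeros t h0
        · obtain ⟨x, hx⟩ := Option.ne_none_iff_exists'.1 hl
          rw [ih hl h', hx]
          rfl
      · simp [act, hts]

/-- Only a word all of whose digits are `s` is reset to zero by the odometer `s`; the first
alternative is the empty word. -/
theorem topDigit_of_act_eq_none {s : Bool} {w : List Digit} (h : topDigit (act s w) = none) :
    topDigit w = none ∨ topDigit w = some s := by
  induction w with
  | nil => exact Or.inl rfl
  | cons e l ih =>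
    rcases e with _ | t
    · simp [act, topDigit] at h
    · by_cases hts : t = s
      · subst hts
        simp only [act, if_true, topDigit, Option.or_none] at h
        rcases ih h with h | h <;> simp [topDigit, h]
      · simp [act, hts, topDigit] at h

/-! ### Coset representatives -/

/-- The generator belonging to a digit, and `1` for the digit `none`. -/
def digitGen : Digit → F₂
  | none => 1
  | some s => gen s

/-- Auxiliary recursion for `tau`. -/
def tauFrom : ℕ → List Digit → F₂
  | _, [] => 1
  | j, e :: l => tauFrom (j + 1) l * digitGen e ^ 2 ^ j

/-- An element of the free group that takes the zero word to the given one. -/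
def tau (w : List Digit) : F₂ := tauFrom 0 w

theorem tau_append_singleton (w : List Digit) (e : Digit) :
    tau (w ++ [e]) = digitGen e ^ 2 ^ w.length * tau w := by
  have : ∀ j, tauFrom j (w ++ [e]) = digitGen e ^ 2 ^ (j + w.length) * tauFrom j w := by
    induction w with
    | nil => simp [tauFrom]
    | cons e' l ih =>
      intro j
      simp only [List.cons_append, tauFrom, ih, List.length_cons, mul_assoc]
      rw [show j + 1 + l.length = j + (l.length + 1) by omega]
  simpa [tau] using this 0

theorem tau_zeros (k : ℕ) : tau (zeros k) = 1 := by
  induction k with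
  | zero => rfl
  | succ k ih =>
    rw [zeros, List.replicate_succ', tau_append_singleton, ih]
    simp [digitGen]

theorem ract_tau (w y : List Digit) : ract (tau w) (zeros w.length ++ y) = w ++ y := by
  induction w using List.reverseRecOn generalizing y with
  | nil => exact ract_one _
  | append_singleton w e ih =>
    rw [tau_append_singleton, ract_mul, List.length_append, List.length_singleton, zeros,
      List.replicate_succ', List.append_assoc, List.append_assoc]
    rcases e with _ | s
    · simp [digitGen, ract_one, ih]
    · rw [digitGen, ract_gen_pow]
      simp [act, ih]

/-- The subgroup generated by `sideGens s k`. -/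
def sideGroup (s : Bool) (k : ℕ) : Subgroup F₂ := Subgroup.closure (sideGens s k)

theorem sideGroup_le (s : Bool) (k : ℕ) : sideGroup s k ≤ G k :=
  (Subgroup.closure_le _).2 (sideGens_subset s k)

theorem conj_mem_sideGroup (t s : Bool) (k : ℕ) {h : F₂} (hh : h ∈ sideGroup s k) :
    gen t ^ 2 ^ k * h * (gen t ^ 2 ^ k)⁻¹ ∈ sideGroup t (k + 1) := by
  have : sideGroup s k ≤
      (sideGroup t (k + 1)).comap (MulAut.conj (gen t ^ 2 ^ k)).toMonoidHom := by
    refine (Subgroup.closure_le _).2 fun g hg => ?_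
    refine Subgroup.subset_closure ?_
    by_cases hst : s = t
    · subst hst
      exact Or.inl (Or.inr ⟨g, hg, rfl⟩)
    · rw [Bool.eq_not.2 hst] at hg
      exact Or.inr ⟨g, Or.inr hg, rfl⟩
  exact this hh

theorem conj_gen_mem_sideGroup {s t : Bool} (h : t ≠ s) (k : ℕ) :
    gen t ^ 2 ^ k * gen s ^ 2 ^ k * (gen t ^ 2 ^ k)⁻¹ ∈ sideGroup t (k + 1) := by
  refine Subgroup.subset_closure (Or.inr ⟨_, Or.inl ?_, rfl⟩)
  rw [Bool.eq_not.2 h.symm]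
  rfl

theorem sideGroup_mono (s : Bool) (k : ℕ) : sideGroup s k ≤ sideGroup s (k + 1) :=
  Subgroup.closure_mono fun _ hg => Or.inl (Or.inl hg)

/-- The Schreier generators of `G k` belonging to the transversal `tau`. -/
theorem schreier_generators (s : Bool) (w : List Digit) :
    (∀ x, topDigit (act s w) = some x →
      tau w * gen s * (tau (act s w))⁻¹ ∈ sideGroup x w.length) ∧
    (topDigit (act s w) = none →
      tau w * gen s * (gen s ^ 2 ^ w.length)⁻¹ ∈ sideGroup s w.length) := by
  induction w using List.reverseRecOn with
  | nil => simp [act, topDigit, tau, tauFrom, one_mem]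
  | append_singleton w e ih =>
    have hlen : (w ++ [e]).length = w.length + 1 := by simp
    rw [hlen, act_append, tau_append_singleton]
    -- If `act s w` is zero, the carry reaches the last digit `e`: it fills a zero, resets `s`, or
    -- is absorbed by the other letter. Otherwise `e` is untouched and contributes at most a
    -- conjugation.
    rcases hx : topDigit (act s w) with _ | x
    · have hz : act s w = zeros w.length := by
        have := eq_zeros_of_topDigit hx
        rwa [length_act] at this
      have hr := ih.2 hx
      rw [hz, if_pos rfl]
      have htop : ∀ e', topDigit (zeros w.length ++ [e']) = e' := fun e' => by
        simp [topDigit_append, topDigit_zeros, topDigit]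
      have htau : ∀ e', tau (zeros w.length ++ [e']) = digitGen e' ^ 2 ^ w.length := fun e' => by
        simp [tau_append_singleton, tau_zeros]
      rcases e with _ | t
      · simp only [act, htop, htau]
        refine ⟨fun x hx => ?_, fun h => by simp at h⟩
        obtain rfl : s = x := by simpa using hx
        simpa [digitGen] using sideGroup_mono _ _ hr
      · by_cases hts : t = s
        · subst hts
          simp only [act, if_true, htop]
          refine ⟨fun x hx => by simp at hx, fun _ => ?_⟩
          have := conj_mem_sideGroup t t _ hr
          convert this using 1
          rw [digitGen, pow_succ, mul_two, pow_add]
          group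
        · simp only [act, if_neg hts, htop, htau]
          refine ⟨fun x hx => ?_, fun h => by simp at h⟩
          obtain rfl : t = x := by simpa using hx
          -- With `c = gen t ^ 2 ^ w.length`, the generator is `c r c⁻¹` times `c (gen s ^ 2 ^
          -- w.length) c⁻¹`, where `r` is the element of the induction hypothesis.
          have := mul_mem (conj_mem_sideGroup t s _ hr) (conj_gen_mem_sideGroup hts w.length)
          convert this using 1
          rw [digitGen]
          group
    · have hz : act s w ≠ zeros w.length := fun h => by
        rw [h, topDigit_zeros] at hx
        cases hx
      rw [if_neg hz, tau_append_singleton, topDigit_append, length_act, hx]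
      have hr := ih.1 x hx
      rcases e with _ | t
      · simp only [topDigit]
        refine ⟨fun y hy => ?_, fun h => by simp at h⟩
        obtain rfl : x = y := by simpa using hy
        simpa [digitGen] using sideGroup_mono _ _ hr
      · simp only [topDigit]
        refine ⟨fun y hy => ?_, fun h => by simp at h⟩
        obtain rfl : t = y := by simpa using hy
        convert conj_mem_sideGroup t x _ hr using 1
        rw [digitGen]
        group

/-! ### Words as names of the cosets -/

theorem coset_eq_iff {k : ℕ} {g h : F₂} : coset k g = coset k h ↔ h * g⁻¹ ∈ G k := by
  rw [← QuotientGroup.rightRel_apply]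
  exact Quotient.eq (r := QuotientGroup.rightRel (G k))

theorem coset_tau_step (s : Bool) (w : List Digit) :
    coset w.length (tau w * gen s) = coset w.length (tau (act s w)) := by
  refine Eq.symm (coset_eq_iff.2 ?_)
  rcases hx : topDigit (act s w) with _ | x
  · have hz := eq_zeros_of_topDigit hx
    have := mul_mem (sideGroup_le _ _ ((schreier_generators s w).2 hx)) (gen_pow_mem s w.length)
    rw [hz, tau_zeros]
    simpa using this
  · exact sideGroup_le _ _ ((schreier_generators s w).1 x hx)

/-- Taking `w` to be the zero word shows that the coset of `g` depends only on where `g` sends that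
word. -/
theorem coset_tau_mul (g : F₂) {k : ℕ} (w : List Digit) (hw : w.length = k) :
    coset k (tau w * g) = coset k (tau (ract g w)) := by
  induction g using free_induction generalizing w with
  | one => rw [mul_one, ract_one]
  | of s =>
    subst hw
    rw [ract_gen, coset_tau_step]
  | inv g ih =>
    have := ih (ract g⁻¹ w) (by rw [length_ract, hw])
    rw [ract_ract_inv, coset_eq_iff] at this
    rw [coset_eq_iff]
    have h2 := inv_mem this
    convert h2 using 1
    group
  | mul g h ihg ihh =>
    rw [ract_mul, ← ihh _ (by rw [length_ract, hw])]
    have := coset_eq_iff.1 (ihg w hw)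
    rw [coset_eq_iff]
    convert this using 1
    group

/-- The group `G k` is the stabilizer of the zero word of length `k`. -/
theorem mem_G_iff {k : ℕ} {g : F₂} : g ∈ G k ↔ ract g (zeros k) = zeros k := by
  refine ⟨ract_zeros_of_mem, fun h => ?_⟩
  have := coset_tau_mul g (zeros k) List.length_replicate
  rw [h, tau_zeros, coset_eq_iff] at this
  simpa using this

/-- The name of a vertex of the `k`-th Schreier graph: a word of length `k`. -/
def code {k : ℕ} (w : Coset k) : List Digit :=
  Quotient.lift (s := QuotientGroup.rightRel (G k)) (fun g => ract g (zeros k)) (fun g h hgh => by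
    have := ract_zeros_of_mem (QuotientGroup.rightRel_apply.1 hgh)
    rw [ract_mul] at this
    simpa [ract_ract_inv] using (congrArg (ract g) this).symm) w

theorem code_coset (k : ℕ) (g : F₂) : code (coset k g) = ract g (zeros k) := rfl

theorem exists_coset {k : ℕ} (w : Coset k) : ∃ g, coset k g = w := Quotient.exists_rep w

theorem code_injective (k : ℕ) : Function.Injective (code (k := k)) := by
  intro w w' h
  obtain ⟨g, rfl⟩ := exists_coset w
  obtain ⟨g', rfl⟩ := exists_coset w'
  rw [code_coset, code_coset] at h
  rw [coset_eq_iff, mem_G_iff, ract_mul, ← h, ract_inv_ract]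

theorem length_code {k : ℕ} (w : Coset k) : (code w).length = k := by
  obtain ⟨g, rfl⟩ := exists_coset w
  rw [code_coset, length_ract, List.length_replicate]

theorem code_step {k : ℕ} (w : Coset k) (s : Bool) : code (w.step s) = act s (code w) := by
  obtain ⟨g, rfl⟩ := exists_coset w
  rw [Coset.step_coset, code_coset, code_coset, ract_mul, ract_gen]

theorem code_proj {k : ℕ} (w : Coset (k + 1)) : code w.proj = (code w).take k := by
  obtain ⟨g, rfl⟩ := exists_coset w
  rw [Coset.proj_coset, code_coset, code_coset, take_ract]
  simp

theorem code_tau (w : List Digit) : code (coset w.length (tau w)) = w := by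
  rw [code_coset]
  simpa using ract_tau w []

theorem exists_code_eq {k : ℕ} {l : List Digit} (hl : l.length = k) :
    ∃ w : Coset k, code w = l := by
  subst hl
  exact ⟨_, code_tau l⟩

theorem code_one (k : ℕ) : code (coset k 1) = zeros k := ract_one _

theorem code_gen {k : ℕ} (s : Bool) : code (coset k (gen s)) = act s (zeros k) := ract_gen s _

end Schori

namespace Schori

/-! ### Points and open sets of the Schreier graphs -/

section Graph

variable {k : ℕ}

/-- The point with parameter `t` of the edge with letter `s` that starts at `w`. -/
def edge (w : Coset k) (s : Bool) (t : unitInterval) : Graph k := Quot.mk _ (Sum.inr (w, s, t))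

theorem edge_zero (w : Coset k) (s : Bool) : edge w s 0 = vertex w := Quot.sound (Glue.source w s)

theorem edge_one (w : Coset k) (s : Bool) : edge w s 1 = vertex (w.step s) :=
  Quot.sound (Glue.target w s)

theorem bond_edge (w : Coset (k + 1)) (s : Bool) (t : unitInterval) :
    bond k (edge w s t) = edge w.proj s t := rfl

theorem bond_vertex (w : Coset (k + 1)) : bond k (vertex w) = vertex w.proj := rfl

theorem exists_edge (p : Graph k) : ∃ w s t, p = edge w s t := by
  obtain ⟨x, rfl⟩ := Quot.exists_rep p
  rcases x with w | ⟨w, s, t⟩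
  · exact ⟨w, true, 0, (edge_zero w true).symm⟩
  · exact ⟨w, s, t, rfl⟩

open Classical in
/-- The representative of a point of the graph which is a vertex or an inner point of an edge. -/
noncomputable def normalForm : Graph k → Pieces k :=
  Quot.lift (Sum.elim Sum.inl fun e =>
      if e.2.2 = 0 then Sum.inl e.1
      else if e.2.2 = 1 then Sum.inl (e.1.step e.2.1) else Sum.inr e) (by
    rintro _ _ (⟨w, s⟩ | ⟨w, s⟩) <;> simp)

theorem normalForm_vertex (w : Coset k) : normalForm (vertex w) = Sum.inl w := rfl

theorem normalForm_edge {w : Coset k} {s : Bool} {t : unitInterval} (h0 : t ≠ 0) (h1 : t ≠ 1) :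
    normalForm (edge w s t) = Sum.inr (w, s, t) := by
  classical
  change (if t = 0 then Sum.inl w else if t = 1 then Sum.inl (w.step s) else Sum.inr (w, s, t)) = _
  rw [if_neg h0, if_neg h1]

theorem vertex_injective : Function.Injective (vertex (k := k)) := fun w w' h => by
  simpa [normalForm_vertex] using congrArg normalForm h

theorem edge_ne_vertex {w w' : Coset k} {s : Bool} {t : unitInterval} (h0 : t ≠ 0) (h1 : t ≠ 1) :
    edge w s t ≠ vertex w' := fun h => by
  simpa [normalForm_vertex, normalForm_edge h0 h1] using congrArg normalForm h

theorem edge_inj {w w' : Coset k} {s s' : Bool} {t t' : unitInterval} (h0 : t ≠ 0) (h1 : t ≠ 1)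
    (h : edge w s t = edge w' s' t') : w = w' ∧ s = s' ∧ t = t' := by
  by_cases h0' : t' = 0
  · rw [h0', edge_zero] at h
    exact absurd h (edge_ne_vertex h0 h1)
  by_cases h1' : t' = 1
  · rw [h1', edge_one] at h
    exact absurd h (edge_ne_vertex h0 h1)
  simpa [normalForm_edge, h0, h1, h0', h1'] using congrArg normalForm h

/-- A point of the graph is a vertex or an inner point of an edge. -/
theorem vertex_or_edge (p : Graph k) :
    (∃ w, p = vertex w) ∨ ∃ w s t, t ≠ 0 ∧ t ≠ 1 ∧ p = edge w s t := by
  obtain ⟨w, s, t, rfl⟩ := exists_edge p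
  by_cases h0 : t = 0
  · exact Or.inl ⟨w, by rw [h0, edge_zero]⟩
  by_cases h1 : t = 1
  · exact Or.inl ⟨w.step s, by rw [h1, edge_one]⟩
  exact Or.inr ⟨w, s, t, h0, h1, rfl⟩

theorem edge_ne_vertex_of_ne {w b : Coset k} {s : Bool} (t : unitInterval) (h : w ≠ b)
    (h' : w.step s ≠ b) : edge w s t ≠ vertex b := by
  by_cases h0 : t = 0
  · rw [h0, edge_zero]
    exact fun e => h (vertex_injective e)
  by_cases h1 : t = 1
  · rw [h1, edge_one]
    exact fun e => h' (vertex_injective e)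
  exact edge_ne_vertex h0 h1

theorem continuous_edge (w : Coset k) (s : Bool) : Continuous (edge w s) :=
  continuous_quot_mk.comp (continuous_inr.comp (by fun_prop))

/-- The quotient topology imposes no separate condition at vertices, because the vertices form a
discrete piece before gluing. -/
theorem isOpen_graph_iff {U : Set (Graph k)} :
    IsOpen U ↔ ∀ w s, IsOpen {t | edge w s t ∈ U} := by
  refine ⟨fun h w s => h.preimage (continuous_edge w s), fun h => ?_⟩
  refine (isQuotientMap_quot_mk (r := Glue k)).isOpen_preimage.1 ?_
  refine isOpen_sum_iff.2 ⟨isOpen_discrete _, ?_⟩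
  have : (Sum.inr ⁻¹' (Quot.mk (Glue k) ⁻¹' U) : Set (Coset k × Bool × unitInterval)) =
      ⋃ w : Coset k, ⋃ s : Bool, {w} ×ˢ ({s} ×ˢ {t | edge w s t ∈ U}) := by
    ext ⟨w, s, t⟩
    constructor
    · intro ht
      exact mem_iUnion₂.2 ⟨w, s, rfl, rfl, ht⟩
    · intro ht
      obtain ⟨w', s', rfl, rfl, ht⟩ := mem_iUnion₂.1 ht
      exact ht
  rw [this]
  exact isOpen_iUnion fun w => isOpen_iUnion fun s =>
    (isOpen_discrete _).prod ((isOpen_discrete _).prod (h w s))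

theorem isClosed_graph_iff {U : Set (Graph k)} :
    IsClosed U ↔ ∀ w s, IsClosed {t | edge w s t ∈ U} := by
  simp only [← isOpen_compl_iff, isOpen_graph_iff]
  rfl

/-! ### Open stars and separating vertices. -/

/-- The open star of a set of vertices. -/
def star (W : Set (Coset k)) : Set (Graph k) :=
  {p | Sum.elim (· ∈ W) (fun e => e.1 ∈ W ∨ e.1.step e.2.1 ∈ W) (normalForm p)}

variable {W : Set (Coset k)}

theorem vertex_mem_star {w : Coset k} : vertex w ∈ star W ↔ w ∈ W := Iff.rfl

theorem edge_mem_star {w : Coset k} {s : Bool} {t : unitInterval} (h0 : t ≠ 0) (h1 : t ≠ 1) :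
    edge w s t ∈ star W ↔ w ∈ W ∨ w.step s ∈ W := by
  simp [star, normalForm_edge h0 h1]

theorem or_of_edge_mem_star {w : Coset k} {s : Bool} {t : unitInterval}
    (h : edge w s t ∈ star W) : w ∈ W ∨ w.step s ∈ W := by
  by_cases h0 : t = 0
  · rw [h0, edge_zero] at h
    exact Or.inl h
  by_cases h1 : t = 1
  · rw [h1, edge_one] at h
    exact Or.inr h
  exact (edge_mem_star h0 h1).1 h

theorem star_mono {W' : Set (Coset k)} (h : W ⊆ W') : star W ⊆ star W' := by
  intro p hp
  rcases vertex_or_edge p with ⟨w, rfl⟩ | ⟨w, s, t, h0, h1, rfl⟩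
  · exact h hp
  · rw [edge_mem_star h0 h1] at hp ⊢
    exact hp.imp (@h _) (@h _)

theorem isOpen_star (W : Set (Coset k)) : IsOpen (star W) := by
  refine isOpen_graph_iff.2 fun w s => isOpen_iff_mem_nhds.2 fun t ht => ?_
  -- Parameters near `t` do not reach an endpoint of the edge unless `t` is that endpoint.
  have hmem : ∀ᶠ u in 𝓝 t, (u = 0 → t = 0) ∧ (u = 1 → t = 1) := by
    have : ∀ a : unitInterval, ∀ᶠ u in 𝓝 t, (u = a → t = a) := fun a => by
      by_cases h : t = a
      · exact Eventually.of_forall fun _ _ => h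
      · filter_upwards [isOpen_ne.mem_nhds h] with u hu hu'
        exact absurd hu' hu
    exact (this 0).and (this 1)
  filter_upwards [hmem] with u hu
  by_cases h0 : u = 0
  · rw [h0, ← hu.1 h0]
    exact ht
  by_cases h1 : u = 1
  · rw [h1, ← hu.2 h1]
    exact ht
  exact (edge_mem_star h0 h1).2 (or_of_edge_mem_star ht)

/-- `b` separates `W` from the rest: an edge with an end in `W` has its other end in `W` or
at `b`. -/
structure IsCut (W : Set (Coset k)) (b : Coset k) : Prop where
  notMem : b ∉ W
  step : ∀ w s, w ∈ W → w.step s ∈ W ∨ w.step s = b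
  of_step : ∀ w s, w.step s ∈ W → w ∈ W ∨ w = b

variable {b : Coset k}

/-- Each edge lies entirely in this set or meets it at most in its endpoints. -/
theorem IsCut.isClosed_union (h : IsCut W b) : IsClosed (star W ∪ {vertex b}) := by
  refine isClosed_graph_iff.2 fun w s => ?_
  by_cases hw : w ∈ W ∨ w.step s ∈ W
  · convert isClosed_univ
    refine eq_univ_of_forall fun t => ?_
    by_cases h0 : t = 0
    · rw [mem_ofPred_eq, h0, edge_zero]
      have : w ∈ W ∨ w = b := hw.elim Or.inl (h.of_step w s)
      exact this.imp id (congrArg vertex)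
    by_cases h1 : t = 1
    · rw [mem_ofPred_eq, h1, edge_one]
      have : w.step s ∈ W ∨ w.step s = b := hw.elim (h.step w s) Or.inl
      exact this.imp id (congrArg vertex)
    exact Or.inl ((edge_mem_star h0 h1).2 hw)
  · refine Finite.isClosed (Finite.subset (s := {0, 1}) (by simp) fun t ht => ?_)
    rcases ht with ht | ht
    · exact absurd (or_of_edge_mem_star ht) hw
    · by_contra hne
      simp only [mem_insert_iff, mem_singleton_iff, not_or] at hne
      exact edge_ne_vertex hne.1 hne.2 ht

/-- Away from `vertex b` the star of `W` is both open and closed. -/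
theorem IsCut.subset_star (h : IsCut W b) {S : Set (Graph k)} (hS : IsPreconnected S)
    (hb : vertex b ∉ S) (hne : (S ∩ star W).Nonempty) : S ⊆ star W := by
  refine hS.subset_left_of_subset_union (isOpen_star W) h.isClosed_union.isOpen_compl
    (disjoint_left.2 fun x hx hx' => hx' (Or.inl hx)) (fun x hx => ?_) hne
  by_cases hxs : x ∈ star W
  · exact Or.inl hxs
  · refine Or.inr fun h' => ?_
    rcases h' with h' | h'
    · exact hxs h'
    · rw [mem_singleton_iff] at h'
      exact hb (h' ▸ hx)

/-- The open set of the points that are closer to the vertex `w` than to any other vertex. -/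
def halfStar (w : Coset k) : Set (Graph k) :=
  {p | Sum.elim (· = w) (fun e => ((e.2.2 : ℝ) < 1 / 2 ∧ e.1 = w) ∨
    (1 / 2 < (e.2.2 : ℝ) ∧ e.1.step e.2.1 = w)) (normalForm p)}

theorem vertex_mem_halfStar {w w' : Coset k} : vertex w ∈ halfStar w' ↔ w = w' := Iff.rfl

theorem edge_mem_halfStar {w w' : Coset k} {s : Bool} {t : unitInterval} :
    edge w s t ∈ halfStar w' ↔
      ((t : ℝ) < 1 / 2 ∧ w = w') ∨ (1 / 2 < (t : ℝ) ∧ w.step s = w') := by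
  by_cases h0 : t = 0
  · subst h0
    rw [edge_zero, vertex_mem_halfStar]
    norm_num
  by_cases h1 : t = 1
  · subst h1
    rw [edge_one, vertex_mem_halfStar]
    norm_num
  simp [halfStar, normalForm_edge h0 h1]

theorem isOpen_halfStar (w : Coset k) : IsOpen (halfStar w) := by
  refine isOpen_graph_iff.2 fun w' s => ?_
  simp only [edge_mem_halfStar, ofPred_or]
  exact ((isOpen_lt continuous_subtype_val continuous_const).inter isOpen_const).union
    ((isOpen_lt continuous_const continuous_subtype_val).inter isOpen_const)

theorem eq_of_mem_halfStar {p : Graph k} {w w' : Coset k} (h : p ∈ halfStar w)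
    (h' : p ∈ halfStar w') : w = w' := by
  obtain ⟨u, s, t, rfl⟩ := exists_edge p
  rw [edge_mem_halfStar] at h h'
  rcases h with ⟨h, rfl⟩ | ⟨h, rfl⟩ <;> rcases h' with ⟨h', rfl⟩ | ⟨h', rfl⟩
  · rfl
  · exact absurd h h'.not_gt
  · exact absurd h h'.not_gt
  · rfl

theorem edge_mem_iUnion_halfStar {w : Coset k} {s : Bool} {t : unitInterval} :
    edge w s t ∈ ⋃ w', halfStar w' ↔ (t : ℝ) ≠ 1 / 2 := by
  simp only [mem_iUnion, edge_mem_halfStar]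
  constructor
  · rintro ⟨w', ⟨h, -⟩ | ⟨h, -⟩⟩
    exacts [h.ne, h.ne']
  · intro h
    rcases h.lt_or_gt with h | h
    exacts [⟨w, Or.inl ⟨h, rfl⟩⟩, ⟨_, Or.inr ⟨h, rfl⟩⟩]

/-- The half stars are pairwise disjoint open sets, so a connected set in their union lies in one of
them. -/
theorem eq_of_vertex_mem_of_subset_halfStar {S : Set (Graph k)} (hS : IsPreconnected S)
    (hsub : S ⊆ ⋃ w, halfStar w) {w w' : Coset k} (hw : vertex w ∈ S) (hw' : vertex w' ∈ S) :
    w = w' := by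
  have : S ⊆ halfStar w := by
    refine hS.subset_left_of_subset_union (v := ⋃ u ∈ ({w}ᶜ : Set (Coset k)), halfStar u)
      (isOpen_halfStar w) (isOpen_biUnion fun u _ => isOpen_halfStar u) ?_ ?_
      ⟨_, hw, vertex_mem_halfStar.2 rfl⟩
    · refine disjoint_left.2 fun x hx hx' => ?_
      obtain ⟨u, hu, hxu⟩ := mem_iUnion₂.1 hx'
      exact hu (eq_of_mem_halfStar hxu hx)
    · intro x hx
      obtain ⟨u, hu⟩ := mem_iUnion.1 (hsub hx)
      by_cases huw : u = w
      · exact Or.inl (huw ▸ hu)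
      · exact Or.inr (mem_iUnion₂.2 ⟨u, huw, hu⟩)
  exact (vertex_mem_halfStar.1 (this hw')).symm

theorem isOpen_compl_range_vertex : IsOpen (range (vertex (k := k)))ᶜ := by
  refine isOpen_compl_iff.2 (isClosed_graph_iff.2 fun w s => ?_)
  refine Finite.isClosed (Finite.subset (s := {0, 1}) (by simp) fun t ⟨u, hu⟩ => ?_)
  by_contra hne
  simp only [mem_insert_iff, mem_singleton_iff, not_or] at hne
  exact edge_ne_vertex hne.1 hne.2 hu.symm

end Graph

end Schori

namespace Schori

/-! ### The vertices of the side components -/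

/-- Two words with property `P` are adjacent if one of them is the image of the other under one of
the odometers. -/
def Adj (P : List Digit → Prop) (l l' : List Digit) : Prop :=
  P l ∧ P l' ∧ ∃ s, l' = act s l ∨ l = act s l'

theorem act_append_of_topDigit {s x : Bool} {p : List Digit} (h : topDigit (act s p) = some x)
    (q : List Digit) : act s (p ++ q) = act s p ++ q := by
  rw [act_append, if_neg]
  intro h'
  rw [h', topDigit_zeros] at h
  cases h

/-- No step between words with a nonzero top digit carries out of them, so a suffix can be attached
to a whole chain. -/
theorem reflTransGen_adj_append {P Q : List Digit → Prop} {d : Bool} {q : List Digit}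
    (hP : ∀ l, P l → topDigit l = some d) (hPQ : ∀ l, P l → Q (l ++ q)) {l l' : List Digit}
    (h : Relation.ReflTransGen (Adj P) l l') :
    Relation.ReflTransGen (Adj Q) (l ++ q) (l' ++ q) := by
  refine h.lift (· ++ q) fun a b hab => ⟨hPQ _ hab.1, hPQ _ hab.2.1, ?_⟩
  obtain ⟨s, rfl | rfl⟩ := hab.2.2
  · exact ⟨s, Or.inl (act_append_of_topDigit (hP _ hab.2.1) _).symm⟩
  · exact ⟨s, Or.inr (act_append_of_topDigit (hP _ hab.1) _).symm⟩

theorem topDigit_append_singleton (p : List Digit) (e : Digit) :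
    topDigit (p ++ [e]) = e.or (topDigit p) := by
  simp [topDigit_append, topDigit]

theorem length_pos_of_topDigit {p : List Digit} {d : Bool} (h : topDigit p = some d) :
    0 < p.length := by
  rcases p with _ | ⟨e, p⟩
  · cases h
  · simp

/-- The words with most significant nonzero digit `some d` are connected to each other. -/
theorem reflTransGen_of_topDigit (d : Bool) (p : List Digit) (hp : topDigit p = some d) :
    Relation.ReflTransGen (Adj (topDigit · = some d)) (act d (zeros p.length)) p := by
  obtain ⟨n, hn⟩ : ∃ n, p.length = n := ⟨_, rfl⟩
  induction n generalizing d p with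
  | zero =>
    rw [List.length_eq_zero_iff.1 hn] at hp
    cases hp
  | succ n ih =>
    obtain ⟨p, e, rfl⟩ : ∃ q e, p = q ++ [e] :=
      ⟨_, _, (List.dropLast_append_getLast (List.ne_nil_of_length_eq_add_one hn)).symm⟩
    have hn' : p.length = n := by simpa using hn
    have hz : zeros (p ++ [e]).length = zeros p.length ++ [none] := by
      rw [zeros, List.length_append, List.length_singleton, List.replicate_succ']
    have happ : ∀ {x e}, 0 < p.length →
        act x (zeros p.length ++ [e]) = act x (zeros p.length) ++ [e] := fun h =>
      act_append_of_topDigit (topDigit_act_zeros _ h) _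
    rw [topDigit_append_singleton] at hp
    rw [hz]
    rcases e with _ | e
    · have hp' : topDigit p = some d := by simpa using hp
      rw [happ (length_pos_of_topDigit hp')]
      refine reflTransGen_adj_append (d := d) (fun l hl => hl) (fun l hl => ?_) (ih d p hp' hn')
      rw [topDigit_append_singleton, hl]
      rfl
    · obtain rfl : e = d := by simpa using hp
      have htop : ∀ l : List Digit, topDigit (l ++ [some e]) = some e := fun l => by
        rw [topDigit_append_singleton]
        rfl
      -- With last digit zero, the chain runs to the predecessor of the zero prefix, all of whose
      -- digits are `e`. One further step carries into the last digit.
      have hM : Relation.ReflTransGen (Adj (topDigit · = some e))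
          (act e (zeros p.length ++ [none])) (zeros p.length ++ [some e]) := by
        rcases Nat.eq_zero_or_pos p.length with h0 | h0
        · rw [h0]
          exact Relation.ReflTransGen.refl
        · have hact : act e (actInv e (zeros p.length)) = zeros p.length := act_actInv _ _
          have hlen : (actInv e (zeros p.length)).length = p.length := by
            rw [← length_act e, hact, List.length_replicate]
          have hz' : topDigit (actInv e (zeros p.length)) = some e := by
            refine (topDigit_of_act_eq_none (s := e) ?_).resolve_left fun h => ?_
            · rw [hact, topDigit_zeros]
            · have h2 := eq_zeros_of_topDigit h
              rw [hlen] at h2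
              have h3 := topDigit_act_zeros e h0
              rw [← h2, hact, topDigit_zeros] at h3
              cases h3
          have h1 := reflTransGen_adj_append (Q := (topDigit · = some e)) (q := [none])
            (fun l hl => hl) (fun l hl => by rw [topDigit_append_singleton, hl]; rfl)
            (ih e _ hz' (hlen.trans hn'))
          rw [hlen, ← happ h0] at h1
          refine h1.tail ⟨?_, htop _, e, Or.inl ?_⟩
          · change topDigit _ = _
            rw [topDigit_append_singleton, hz']
            rfl
          · rw [act_append, hact, hlen, if_pos rfl]
            simp [act]
      rcases hp' : topDigit p with _ | x
      · rwa [← eq_zeros_of_topDigit hp'] at hM ⊢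
      -- With last digit `e` the top digit is fixed, so the prefix may leave zero by its own letter
      -- `x`, whichever that is.
      · refine hM.trans (Relation.ReflTransGen.head ⟨htop _, ?_, x, Or.inl rfl⟩ ?_)
        · rw [happ (length_pos_of_topDigit hp')]
          exact htop _
        · rw [happ (length_pos_of_topDigit hp')]
          exact reflTransGen_adj_append (d := x) (fun l hl => hl) (fun l _ => htop l) (ih x p hp' hn')

/-- A chain of adjacent vertices stays in a connected component. -/
theorem mem_connectedComponentIn_of_reflTransGen {k : ℕ} {P : List Digit → Prop}
    {F : Set (Graph k)}
    (hF : ∀ (u : Coset k) s, P (code u) → P (code (u.step s)) → ∀ t, edge u s t ∈ F)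
    {w w' : Coset k} (hw : vertex w ∈ F)
    (h : Relation.ReflTransGen (Adj P) (code w) (code w')) :
    vertex w' ∈ connectedComponentIn F (vertex w) := by
  have hedge : ∀ (u : Coset k) s, P (code u) → P (code (u.step s)) →
      connectedComponentIn F (vertex u) = connectedComponentIn F (vertex (u.step s)) := by
    intro u s hu hus
    refine connectedComponentIn_eq ?_
    have hpre : IsPreconnected (range (edge u s)) := isPreconnected_range (continuous_edge u s)
    refine hpre.subset_connectedComponentIn ⟨0, edge_zero u s⟩ ?_ ⟨1, edge_one u s⟩
    rintro _ ⟨t, rfl⟩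
    exact hF u s hu hus t
  suffices ∀ l, Relation.ReflTransGen (Adj P) (code w) l → ∃ u : Coset k, code u = l ∧
      vertex u ∈ connectedComponentIn F (vertex w) by
    obtain ⟨u, hu, hmem⟩ := this _ h
    rwa [← code_injective k hu]
  intro l hl
  induction hl with
  | refl => exact ⟨w, rfl, mem_connectedComponentIn hw⟩
  | tail _ hab ih =>
    obtain ⟨u, rfl, hu⟩ := ih
    obtain ⟨hPu, hPb, s, rfl | hb⟩ := hab
    · rw [← code_step] at hPb
      refine ⟨u.step s, code_step u s, ?_⟩
      rw [connectedComponentIn_eq hu, hedge u s hPu hPb]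
      refine mem_connectedComponentIn ?_
      rw [← edge_one]
      exact hF u s hPu hPb 1
    · rename_i l' _
      obtain ⟨u', rfl⟩ := exists_code_eq (k := k) (l := l') (by
        rw [← length_act s, ← hb, length_code])
      obtain rfl : u = u'.step s := code_injective k (by rw [hb, code_step])
      refine ⟨u', rfl, ?_⟩
      rw [connectedComponentIn_eq hu, ← hedge u' s hPb hPu]
      refine mem_connectedComponentIn ?_
      rw [← edge_zero u' s]
      exact hF u' s hPb hPu 0

theorem isCut_topDigit (k : ℕ) (d : Bool) :
    IsCut {w : Coset k | topDigit (code w) = some d} (coset k 1) where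
  notMem := by
    rw [mem_ofPred_eq, code_one, topDigit_zeros]
    simp
  step w s hw := by
    rcases hx : topDigit (code (w.step s)) with _ | x
    · right
      apply code_injective
      rw [code_one, eq_zeros_of_topDigit hx, length_code]
    · left
      rw [mem_ofPred_eq] at hw ⊢
      rw [code_step] at hx ⊢
      rw [topDigit_act s _ (by simp [hw]) (by simp [hx]), hw]
  of_step w s hw := by
    rcases hx : topDigit (code w) with _ | x
    · right
      apply code_injective
      rw [code_one, eq_zeros_of_topDigit hx, length_code]
    · left
      rw [mem_ofPred_eq] at hw ⊢
      rw [code_step] at hw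
      rw [← topDigit_act s _ (by simp [hx]) (by simp [hw]), hw]

/-- The arm is connected, avoids the cut vertex, and contains the vertex of `gen s`, whose top digit
is `s`. -/
theorem topDigit_code_of_mem_arm {k : ℕ} {s : Bool} {w : Coset (k + 1)}
    (hw : vertex w ∈ arm s (k + 1)) : topDigit (code w) = some s := by
  have h1 : powPt s (k + 1) 1 ∈ arm s (k + 1) :=
    mem_connectedComponentIn (connectedComponentIn_nonempty_iff.1 ⟨_, hw⟩)
  refine (isCut_topDigit (k + 1) s).subset_star (S := arm s (k + 1))
    isPreconnected_connectedComponentIn (fun h => ?_) ⟨_, h1, ?_⟩ hw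
  · exact connectedComponentIn_subset _ _ h rfl
  · rw [powPt, vertex_mem_star, mem_ofPred_eq, pow_one, code_gen]
    exact topDigit_act_zeros s (Nat.succ_pos k)

theorem ne_coset_one {k : ℕ} {s : Bool} {w : Coset k} (hw : topDigit (code w) = some s) :
    w ≠ coset k 1 := by
  rintro rfl
  rw [code_one, topDigit_zeros] at hw
  cases hw

theorem vertex_mem_arm {k : ℕ} {s : Bool} {w : Coset (k + 1)}
    (hw : topDigit (code w) = some s) : vertex w ∈ arm s (k + 1) := by
  have h1 : topDigit (act s (zeros (k + 1))) = some s := topDigit_act_zeros s (Nat.succ_pos k)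
  refine mem_connectedComponentIn_of_reflTransGen (P := (topDigit · = some s)) ?_ ?_ ?_
  · intro u x hu hux t
    exact edge_ne_vertex_of_ne t (ne_coset_one hu) (ne_coset_one hux)
  · rw [pow_one]
    refine fun h => ne_coset_one (s := s) ?_ (vertex_injective h)
    rw [code_gen, h1]
  · rw [pow_one, code_gen]
    simpa [length_code] using reflTransGen_of_topDigit s (code w) hw

theorem edge_mem_arm {k : ℕ} {s x : Bool} {w : Coset (k + 1)} (hw : topDigit (code w) = some s)
    (hwx : topDigit (code (w.step x)) = some s) (t : unitInterval) :
    edge w x t ∈ arm s (k + 1) := by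
  rw [arm, connectedComponentIn_eq (vertex_mem_arm hw)]
  have hpre : IsPreconnected (range (edge w x)) := isPreconnected_range (continuous_edge w x)
  refine hpre.subset_connectedComponentIn ⟨0, edge_zero w x⟩ ?_ ⟨t, rfl⟩
  rintro _ ⟨t, rfl⟩
  exact edge_ne_vertex_of_ne t (ne_coset_one hw) (ne_coset_one hwx)

theorem code_gen_pow (s : Bool) (k : ℕ) :
    code (coset (k + 1) (gen s ^ 2 ^ k)) = zeros k ++ [some s] := by
  rw [code_coset, zeros, List.replicate_succ', ract_gen_pow]
  rfl

/-- If `p` has most significant nonzero digit `some s`, and the digit `e` is zero or equal to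
`some s`, then the vertices with names `p ++ [e]` and `act s 0 ++ [e]` are in the same component. -/
theorem mem_connectedComponentIn_arm {k : ℕ} {s : Bool} {e : Digit} {p : List Digit}
    (hp : topDigit p = some s) (he : topDigit (p ++ [e]) = some s) {u w : Coset (k + 1)}
    (hw : code w = p ++ [e]) (hu : code u = act s (zeros k) ++ [e]) :
    vertex w ∈ connectedComponentIn (arm s (k + 1) \ {powPt s (k + 1) (2 ^ k)}) (vertex u) := by
  have hlen : p.length = k := by
    have := length_code w
    rw [hw, List.length_append, List.length_singleton] at this
    omega
  have hk : 0 < k := hlen ▸ length_pos_of_topDigit hp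
  have hor : e.or (some s) = some s := by rw [← hp, ← topDigit_append_singleton, he, hp]
  have hne : ∀ {w' : Coset (k + 1)} {l : List Digit}, topDigit l = some s →
      code w' = l ++ [e] → w' ≠ coset (k + 1) (gen s ^ 2 ^ k) := by
    rintro w' l hl hw' rfl
    rw [code_gen_pow] at hw'
    rw [← (List.append_inj' hw' rfl).1, topDigit_zeros] at hl
    cases hl
  have hmem : ∀ {w' : Coset (k + 1)} {l : List Digit}, topDigit l = some s →
      code w' = l ++ [e] → topDigit (code w') = some s := fun hl hw' => by
    rw [hw', topDigit_append_singleton, hl, hor]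
  have htop := topDigit_act_zeros s hk
  refine mem_connectedComponentIn_of_reflTransGen
    (P := fun l' => ∃ l, topDigit l = some s ∧ l' = l ++ [e]) ?_ ?_ ?_
  · rintro u' x ⟨l, hl, hu'⟩ ⟨l', hl', hux⟩ t
    exact ⟨edge_mem_arm (hmem hl hu') (hmem hl' hux) t,
      edge_ne_vertex_of_ne t (hne hl hu') (hne hl' hux)⟩
  · exact ⟨vertex_mem_arm (hmem htop hu), fun h => hne htop hu (vertex_injective h)⟩
  · rw [hu, hw]
    refine reflTransGen_adj_append (d := s) (fun l hl => hl) (fun l hl => ⟨l, hl, rfl⟩) ?_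
    rw [← hlen]
    exact reflTransGen_of_topDigit s p hp

/-- The vertices of the side component: the last two nonzero digits are different, and the last
digit is not zero. -/
theorem code_of_mem_side {k : ℕ} {s : Bool} {w : Coset (k + 1)}
    (hw : vertex w ∈ side s (k + 1)) :
    ∃ p, code w = p ++ [some s] ∧ topDigit p = some (!s) := by
  obtain ⟨⟨harm, hne⟩, hpm⟩ := hw
  have htop := topDigit_code_of_mem_arm harm
  obtain ⟨p, e, hpe⟩ : ∃ p e, code w = p ++ [e] := by
    have hne : code w ≠ [] := fun h => by
      have := length_code w
      simp [h] at this
    exact ⟨_, _, (List.dropLast_append_getLast hne).symm⟩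
  have hlen : p.length = k := by
    have := length_code w
    rw [hpe, List.length_append, List.length_singleton] at this
    omega
  -- Otherwise the vertex is joined to `x ^ 1` if its last digit is zero, or to `x ^ (2 ^ k + 1)` if
  -- it is `s`. It would then lie in one of the two removed components.
  have hp : topDigit p ≠ some s := by
    intro hp
    have hk : 0 < k := hlen ▸ length_pos_of_topDigit hp
    have hk2 : 1 < 2 ^ k := Nat.one_lt_two_pow hk.ne'
    have happ : ∀ e, act s (zeros k ++ [e]) = act s (zeros k) ++ [e] := fun e =>
      act_append_of_topDigit (topDigit_act_zeros s hk) _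
    rw [hpe] at htop
    have htop' := htop
    rw [topDigit_append_singleton, hp] at htop'
    rcases e with _ | e
    · refine hpm (Or.inl (mem_iUnion₂.2 ⟨1, ⟨one_pos, hk2⟩, ?_⟩))
      refine mem_connectedComponentIn_arm hp htop hpe ?_
      rw [pow_one, code_gen, zeros, List.replicate_succ', happ]
    · obtain rfl : e = s := by simpa using htop'
      refine hpm (Or.inr (mem_iUnion₂.2 ⟨2 ^ k + 1, ⟨Nat.lt_succ_self _, ?_⟩, ?_⟩))
      · rw [pow_succ]
        omega
      · refine mem_connectedComponentIn_arm hp htop hpe ?_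
        rw [pow_succ, ← Coset.step_coset, code_step, code_gen_pow, happ]
  rw [hpe, topDigit_append_singleton] at htop
  obtain rfl : e = some s := by
    rcases e with _ | e
    · exact absurd (by simpa using htop) hp
    · simpa using htop
  refine ⟨p, hpe, ?_⟩
  rcases hx : topDigit p with _ | x
  -- A zero prefix followed by `s` names the deleted vertex `x ^ (2 ^ k)`.
  · refine absurd (congrArg vertex (code_injective _ ?_)) hne
    rw [hpe, code_gen_pow, eq_zeros_of_topDigit hx, hlen]
  · rw [hx] at hp
    rw [Bool.eq_not.2 fun h => hp (congrArg some h)]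

end Schori

/-! ### The leaf topology -/

section LeafTopology

variable {X : Type*} [t : TopologicalSpace X]

theorem isOpen_leafTopology_pathComponentIn {O : Set X} (hO : IsOpen O) {x : X} (hx : x ∈ O) :
    IsOpen[leafTopology X] (pathComponentIn O x) :=
  TopologicalSpace.isOpen_generateFrom_of_mem ⟨O, hO, x, hx, rfl⟩

theorem leafTopology_le : leafTopology X ≤ t := by
  intro O hO
  have : O = ⋃ x ∈ O, pathComponentIn O x :=
    Subset.antisymm (fun x hx => mem_iUnion₂.2 ⟨x, hx, mem_pathComponentIn_self hx⟩)
      (iUnion₂_subset fun _ _ => pathComponentIn_subset)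
  rw [this]
  exact @isOpen_biUnion _ _ (leafTopology X) _ _ fun x hx =>
    isOpen_leafTopology_pathComponentIn hO hx

/-- A continuous map on a locally path connected space is continuous for the leaf topology. -/
theorem Continuous.leafTopology {Y : Type*} [TopologicalSpace Y] [LocallyPathConnectedSpace Y]
    {f : Y → X} (hf : Continuous f) : Continuous[_, leafTopology X] f := by
  refine continuous_generateFrom_iff.2 ?_
  rintro _ ⟨O, hO, x, -, rfl⟩
  refine isOpen_iff_mem_nhds.2 fun y hy => ?_
  have hyO : y ∈ f ⁻¹' O := pathComponentIn_subset (F := O) hy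
  have hnhds : pathComponentIn (f ⁻¹' O) y ∈ 𝓝 y :=
    ((hO.preimage hf).pathComponentIn y).mem_nhds (mem_pathComponentIn_self hyO)
  refine mem_of_superset hnhds ?_
  rintro z ⟨γ, hγ⟩
  exact JoinedIn.trans (F := O) hy ⟨γ.map hf, hγ⟩

instance : LocallyPathConnectedSpace unitInterval :=
  (convex_Icc (0 : ℝ) 1).locallyPathConnectedSpace

instance : PathConnectedSpace unitInterval :=
  isPathConnected_iff_pathConnectedSpace.1
    ((convex_Icc (0 : ℝ) 1).isPathConnected ⟨0, left_mem_Icc.2 zero_le_one⟩)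

theorem Path.joinedIn_apply {x y : X} (γ : Path x y) {F : Set X} (h : ∀ t, γ t ∈ F)
    (t : unitInterval) : JoinedIn F x (γ t) :=
  ⟨((PathConnectedSpace.joined 0 t).somePath.map γ.continuous).cast γ.source.symm rfl,
    fun _ => h _⟩

end LeafTopology

namespace Schori

/-! ### The leaf topology on a path component: continuity and connectedness. -/

section Leaf

variable {v : Continuum}

/-- The inclusion of the leaf. -/
def Leaf.val (p : Leaf v) : Continuum := Subtype.val p

theorem Leaf.val_injective : Function.Injective (Leaf.val (v := v)) := Subtype.val_injective

theorem continuous_leaf_val : Continuous (Leaf.val (v := v)) := by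
  have h : Continuous[_, leafTopology Continuum] (Leaf.val (v := v)) :=
    @continuous_induced_dom _ _ _ (leafTopology Continuum)
  exact continuous_le_rng leafTopology_le h

theorem continuous_to_leaf {Y : Type*} [TopologicalSpace Y] [LocallyPathConnectedSpace Y]
    {f : Y → Leaf v} (hf : Continuous fun y => (f y).val) : Continuous f :=
  (@continuous_induced_rng _ _ _ _ _ (leafTopology Continuum) _).2 hf.leafTopology

theorem isOpen_preimage_pathComponentIn {O : Set Continuum} (hO : IsOpen O) {x : Continuum}
    (hx : x ∈ O) : IsOpen (Leaf.val (v := v) ⁻¹' pathComponentIn O x) :=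
  @IsOpen.preimage _ _ _ (leafTopology Continuum) _
    (@continuous_induced_dom _ _ _ (leafTopology Continuum)) _
    (isOpen_leafTopology_pathComponentIn hO hx)

/-- The unit interval is locally path connected, so a path in `O` remains continuous for the leaf
topology. -/
theorem isPreconnected_preimage_pathComponentIn (O : Set Continuum) (p : Leaf v) :
    IsPreconnected (Leaf.val (v := v) ⁻¹' pathComponentIn O p.val) := by
  refine isPreconnected_of_forall p fun q hq => ?_
  obtain ⟨γ, hγ⟩ := hq
  have hmem : ∀ t, γ t ∈ pathComponent v := fun t =>
    (γ.joinedIn_apply hγ t).joined.mem_pathComponent p.2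
  let f : unitInterval → Leaf v := fun t => ⟨γ t, hmem t⟩
  have hf : Continuous f := continuous_to_leaf γ.continuous
  refine ⟨range f, ?_, ⟨0, Leaf.val_injective γ.source⟩, ⟨1, Leaf.val_injective γ.target⟩,
    isPreconnected_range hf⟩
  rintro _ ⟨t, rfl⟩
  exact γ.joinedIn_apply hγ t

instance : PreconnectedSpace (Leaf v) := by
  let p : Leaf v := ⟨v, mem_pathComponent_self v⟩
  refine ⟨isPreconnected_of_forall p fun q _ => ?_⟩
  refine ⟨_, subset_univ _, ?_, ?_, isPreconnected_preimage_pathComponentIn univ p⟩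
  · exact mem_pathComponentIn_self (mem_univ _)
  · rw [mem_preimage, pathComponentIn_univ]
    exact q.2

end Leaf

/-! ### The vertices and the edges of the Schreier continuum -/

theorem continuous_coord (m : ℕ) : Continuous fun p : Continuum => p.1 m :=
  (continuous_apply m).comp continuous_subtype_val

/-- The vertices of the Schreier continuum. -/
def VertexSeq : Type := {y : ∀ k, Coset k // ∀ k, (y (k + 1)).proj = y k}

namespace VertexSeq

theorem ext_of_lt {y y' : VertexSeq} (n : ℕ) (h : ∀ m, n < m → y.1 m = y'.1 m) : y = y' := by
  have hdown : ∀ j m, y.1 (m + j) = y'.1 (m + j) → y.1 m = y'.1 m := by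
    intro j
    induction j with
    | zero => exact fun m h => h
    | succ j ih =>
      intro m h
      refine ih m ?_
      rw [← y.2 (m + j), ← y'.2 (m + j)]
      exact congrArg Coset.proj h
  exact Subtype.ext (funext fun m => hdown (n + 1) m (h _ (by omega)))

theorem take_code (y : VertexSeq) {n m : ℕ} (h : n ≤ m) :
    (code (y.1 m)).take n = code (y.1 n) := by
  induction m, h using Nat.le_induction with
  | base => rw [List.take_of_length_le (length_code _).le]
  | succ m h ih =>
    rw [← ih, ← y.2 m, code_proj, List.take_take, min_eq_left h]

end VertexSeq

/-- The right action of the free group on cosets. -/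
def Coset.mul {k : ℕ} (w : Coset k) (g : F₂) : Coset k :=
  Quotient.map (sa := QuotientGroup.rightRel (G k)) (sb := QuotientGroup.rightRel (G k))
    (fun h => h * g) (fun h h' hh => by
      have hh' := QuotientGroup.rightRel_apply.1 hh
      exact QuotientGroup.rightRel_apply.2 (by simpa [mul_assoc] using hh')) w

theorem Coset.coset_mul (k : ℕ) (h g : F₂) : (coset k h).mul g = coset k (h * g) := rfl

theorem code_mul {k : ℕ} (w : Coset k) (g : F₂) : code (w.mul g) = ract g (code w) := by
  obtain ⟨h, rfl⟩ := exists_coset w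
  rw [Coset.coset_mul, code_coset, code_coset, ract_mul]

theorem Coset.proj_mul {k : ℕ} (w : Coset (k + 1)) (g : F₂) :
    (w.mul g).proj = w.proj.mul g := by
  obtain ⟨h, rfl⟩ := exists_coset w
  rw [Coset.coset_mul, Coset.proj_coset, Coset.proj_coset, Coset.coset_mul]

theorem Coset.mul_gen {k : ℕ} (w : Coset k) (s : Bool) : w.mul (gen s) = w.step s := by
  obtain ⟨h, rfl⟩ := exists_coset w
  rw [Coset.coset_mul, Coset.step_coset]

/-- The right action of the free group on the vertices of the Schreier continuum. -/
def VertexSeq.mul (y : VertexSeq) (g : F₂) : VertexSeq :=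
  ⟨fun k => (y.1 k).mul g, fun k => by rw [Coset.proj_mul, y.2]⟩

theorem VertexSeq.code_mul (y : VertexSeq) (g : F₂) (k : ℕ) :
    code ((y.mul g).1 k) = ract g (code (y.1 k)) := Schori.code_mul _ _

theorem VertexSeq.mul_mul (y : VertexSeq) (g h : F₂) : (y.mul g).mul h = y.mul (g * h) :=
  Subtype.ext (funext fun k => code_injective k (by simp only [code_mul, ract_mul]))

theorem VertexSeq.mul_one (y : VertexSeq) : y.mul 1 = y :=
  Subtype.ext (funext fun k => code_injective k (by simp only [code_mul, ract_one]))

/-- The vertex as a point of the continuum. -/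
def vertexPt (y : VertexSeq) : Continuum :=
  ⟨fun k => vertex (y.1 k), fun k => by rw [bond_vertex, y.2]⟩

/-- The edges of the continuum. -/
def edgePt (y : VertexSeq) (s : Bool) (t : unitInterval) : Continuum :=
  ⟨fun k => edge (y.1 k) s t, fun k => by rw [bond_edge, y.2]⟩

theorem continuous_edgePt (y : VertexSeq) (s : Bool) : Continuous (edgePt y s) :=
  (continuous_pi fun k => continuous_edge (y.1 k) s).subtype_mk _

theorem edgePt_zero (y : VertexSeq) (s : Bool) : edgePt y s 0 = vertexPt y :=
  Subtype.ext (funext fun _ => edge_zero _ _)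

theorem edgePt_one (y : VertexSeq) (s : Bool) : edgePt y s 1 = vertexPt (y.mul (gen s)) :=
  Subtype.ext (funext fun _ => (edge_one _ _).trans (congrArg vertex (Coset.mul_gen _ _).symm))

theorem joined_edgePt (y : VertexSeq) (s : Bool) (t : unitInterval) :
    Joined (vertexPt y) (edgePt y s t) := by
  rw [← edgePt_zero y s]
  exact (PathConnectedSpace.joined (0 : unitInterval) t).map (continuous_edgePt y s)

theorem joined_vertexPt_mul (y : VertexSeq) (g : F₂) :
    Joined (vertexPt y) (vertexPt (y.mul g)) := by
  induction g using free_induction generalizing y with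
  | one =>
    rw [y.mul_one]
  | of s =>
    rw [← edgePt_one]
    exact joined_edgePt y s 1
  | inv g ih =>
    have := ih (y.mul g⁻¹)
    rw [VertexSeq.mul_mul, inv_mul_cancel, VertexSeq.mul_one] at this
    exact this.symm
  | mul g h ihg ihh =>
    rw [← VertexSeq.mul_mul]
    exact (ihg y).trans (ihh _)

theorem exists_vertexPt {p : Continuum} (hp : IsVertex p) : ∃ y, p = vertexPt y := by
  choose y hy using hp
  exact ⟨⟨y, fun k => vertex_injective (by rw [← bond_vertex, hy, hy, p.2])⟩,
    Subtype.ext (funext fun k => (hy k).symm)⟩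

/-- Bonding maps preserve label and parameter, so coordinate 0 already decides which case holds. -/
theorem vertexPt_or_edgePt (p : Continuum) :
    (∃ y, p = vertexPt y) ∨ ∃ y s t, t ≠ 0 ∧ t ≠ 1 ∧ p = edgePt y s t := by
  rcases vertex_or_edge (p.1 0) with ⟨w, hw⟩ | ⟨w, s, t, h0, h1, hw⟩
  · refine Or.inl (exists_vertexPt fun k => ?_)
    induction k with
    | zero => exact ⟨w, hw.symm⟩
    | succ k ih =>
      rcases vertex_or_edge (p.1 (k + 1)) with ⟨w', hw'⟩ | ⟨w', s, t, h0, h1, hw'⟩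
      · exact ⟨w', hw'.symm⟩
      · obtain ⟨u, hu⟩ := ih
        rw [← p.2, hw', bond_edge] at hu
        exact absurd hu.symm (edge_ne_vertex h0 h1)
  · have : ∀ k, ∃ w, p.1 k = edge w s t := by
      intro k
      induction k with
      | zero => exact ⟨w, hw⟩
      | succ k ih =>
        obtain ⟨u, hu⟩ := ih
        obtain ⟨w', s', t', hw'⟩ := exists_edge (p.1 (k + 1))
        have h := p.2 k
        rw [hw', bond_edge, hu] at h
        obtain ⟨-, rfl, rfl⟩ := edge_inj h0 h1 h.symm
        exact ⟨w', hw'⟩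
    choose y hy using this
    refine Or.inr ⟨⟨y, fun k => ?_⟩, s, t, h0, h1, Subtype.ext (funext hy)⟩
    have h := p.2 k
    rw [hy, bond_edge, hy] at h
    exact (edge_inj h0 h1 h).1

theorem vertexPt_coord_of_le {y : VertexSeq} {p : Continuum} {j m : ℕ} (hjm : j ≤ m)
    (h : p.1 m = vertex (y.1 m)) : p.1 j = vertex (y.1 j) := by
  induction m, hjm using Nat.le_induction with
  | base => exact h
  | succ m _ ih =>
    refine ih ?_
    rw [← p.2, h, bond_vertex, y.2]

theorem mem_iUnion_halfStar_coord {p : Continuum} (h : p.1 0 ∈ ⋃ w, halfStar w) (m : ℕ) :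
    p.1 m ∈ ⋃ w, halfStar w := by
  induction m with
  | zero => exact h
  | succ m ih =>
    obtain ⟨w, s, t, hw⟩ := exists_edge (p.1 (m + 1))
    rw [← p.2, hw, bond_edge, edge_mem_iUnion_halfStar] at ih
    rw [hw]
    exact edge_mem_iUnion_halfStar.2 ih

/-- Small connected sets contain at most one vertex. -/
theorem exists_isOpen_subsingleton_vertices (p : Continuum) : ∃ N : Set Continuum, IsOpen N ∧
    p ∈ N ∧ ∀ S ⊆ N, IsPreconnected S → ∀ y y', vertexPt y ∈ S → vertexPt y' ∈ S →
      vertexPt y = vertexPt y' := by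
  -- Only edge midpoints miss the half stars. Such a point has a neighbourhood without vertices.
  by_cases hp : p.1 0 ∈ ⋃ w, halfStar w
  · refine ⟨_, (isOpen_iUnion isOpen_halfStar).preimage (continuous_coord 0), hp, ?_⟩
    intro S hS hpre y y' hy hy'
    refine Subtype.ext (funext fun m => congrArg vertex ?_)
    refine eq_of_vertex_mem_of_subset_halfStar
      (hpre.image _ (continuous_coord m).continuousOn) ?_ ⟨_, hy, rfl⟩ ⟨_, hy', rfl⟩
    rintro _ ⟨q, hq, rfl⟩
    exact mem_iUnion_halfStar_coord (hS hq) m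
  · refine ⟨_, isOpen_compl_range_vertex.preimage (continuous_coord 0), ?_, ?_⟩
    · rintro ⟨w, hw⟩
      change vertex w = p.1 0 at hw
      rw [← hw] at hp
      exact hp (mem_iUnion.2 ⟨w, vertex_mem_halfStar.2 rfl⟩)
    · intro S hS _ y y' hy
      exact absurd ⟨_, rfl⟩ (hS hy)

theorem bond_mem_star {k : ℕ} {W : Set (Coset (k + 1))} {W' : Set (Coset k)}
    (h : ∀ w ∈ W, w.proj ∈ W') {p : Graph (k + 1)} (hp : p ∈ star W) : bond k p ∈ star W' := by
  rcases vertex_or_edge p with ⟨w, rfl⟩ | ⟨w, s, t, h0, h1, rfl⟩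
  · exact h w hp
  · rw [edge_mem_star h0 h1] at hp
    rw [bond_edge, edge_mem_star h0 h1, ← Coset.proj_step]
    exact hp.imp (h _) (h _)

end Schori

namespace Schori

/-! ### Lobes of a leaf -/

/-- The last two nonzero digits among the first `n + 1` digits of `x` are different, and the last
digit is the letter `s`. -/
def FlipsAt (x : VertexSeq) (n : ℕ) (s : Bool) : Prop :=
  ∃ p, code (x.1 (n + 1)) = p ++ [some s] ∧ topDigit p = some (!s)

/-- The vertices of the `m`-th graph whose digits from the `n`-th on are those of `x`, and for which
the most significant nonzero one of the other digits is `some d`. -/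
def region (x : VertexSeq) (n : ℕ) (d : Bool) (m : ℕ) : Set (Coset m) :=
  {w | (code w).drop n = (code (x.1 m)).drop n ∧ topDigit ((code w).take n) = some d}

/-- The vertex that is obtained from `x` by replacing the first `n` digits by zero. -/
def root (x : VertexSeq) (n : ℕ) : VertexSeq := x.mul (tau (code (x.1 n)))⁻¹

variable {x : VertexSeq} {n m l : ℕ} {s s' d : Bool}

theorem code_root (h : n ≤ m) :
    code ((root x n).1 m) = zeros n ++ (code (x.1 m)).drop n := by
  rw [root, VertexSeq.code_mul]
  refine ract_inv_eq ?_
  have := ract_tau (code (x.1 n)) ((code (x.1 m)).drop n)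
  rw [length_code] at this
  rw [this, ← x.take_code h, List.take_append_drop]

theorem FlipsAt.topDigit_code (h : FlipsAt x n s) : topDigit (code (x.1 n)) = some (!s) := by
  obtain ⟨p, hp, hd⟩ := h
  have hlen : p.length = n := by
    have := length_code (x.1 (n + 1))
    rw [hp, List.length_append, List.length_singleton] at this
    omega
  rw [← x.take_code (Nat.le_succ n), hp, ← hlen, List.take_left, hd]

theorem FlipsAt.drop_code (h : FlipsAt x n s) (hm : n < m) :
    ∃ q, (code (x.1 m)).drop n = some s :: q := by
  obtain ⟨p, hp, -⟩ := h
  have hlen : p.length = n := by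
    have := length_code (x.1 (n + 1))
    rw [hp, List.length_append, List.length_singleton] at this
    omega
  refine ⟨(code (x.1 m)).drop (n + 1), ?_⟩
  have h2 := List.take_append_drop (n + 1) (code (x.1 m))
  rw [x.take_code (show n + 1 ≤ m from hm), hp, List.append_assoc] at h2
  rw [← h2, ← hlen, List.drop_left, hlen, h2]
  rfl

theorem eq_root_iff (h : n ≤ m) {w : Coset m} : w = (root x n).1 m ↔
    (code w).drop n = (code (x.1 m)).drop n ∧ topDigit ((code w).take n) = none := by
  have hz : (zeros n).length = n := List.length_replicate
  constructor
  · rintro rfl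
    rw [code_root h]
    exact ⟨by rw [List.drop_left' hz], by rw [List.take_left' hz, topDigit_zeros]⟩
  · rintro ⟨h1, h2⟩
    apply code_injective
    have h3 := eq_zeros_of_topDigit h2
    rw [List.length_take, length_code, min_eq_left h] at h3
    rw [code_root h, ← h1, ← h3, List.take_append_drop]

/-- A step can leave the region only by resetting the first `n` digits, and a flip at `n` blocks the
resulting carry. -/
theorem FlipsAt.isCut (h : FlipsAt x n s) (hm : n < m) :
    IsCut (region x n (!s) m) ((root x n).1 m) := by
  obtain ⟨q, hq⟩ := h.drop_code hm
  -- the first `n` digits and the others, before and after a step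
  have key : ∀ (w : Coset m) y, ∃ p r, p.length = n ∧ (code w).take n = p ∧
      (code w).drop n = r ∧ (code (w.step y)).take n = act y p ∧
      (code (w.step y)).drop n = if act y p = zeros n then act y r else r := by
    intro w y
    have hlen : ((code w).take n).length = n := by
      rw [List.length_take, length_code, min_eq_left hm.le]
    refine ⟨_, _, hlen, rfl, rfl, ?_, ?_⟩
    · rw [code_step, take_act]
    · conv_lhs => rw [code_step, ← List.take_append_drop n (code w), act_append, hlen]
      rw [List.drop_left' (by rw [length_act, hlen])]
  have hzero : ∀ y (p : List Digit), p.length = n →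
      (act y p = zeros n ↔ topDigit (act y p) = none) := fun y p hp =>
    ⟨fun h => by rw [h, topDigit_zeros], fun h => by
      rw [eq_zeros_of_topDigit h, length_act, hp]⟩
  refine ⟨fun hmem => ?_, fun w y hw => ?_, fun w y hw => ?_⟩
  · have h1 := ((eq_root_iff hm.le).1 (rfl : (root x n).1 m = (root x n).1 m)).2
    rw [hmem.2] at h1
    cases h1
  · obtain ⟨p, r, hp, ht, hd, ht', hd'⟩ := key w y
    rw [region, mem_ofPred_eq, ht, hd] at hw
    rw [eq_root_iff hm.le, region, mem_ofPred_eq, ht', hd']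
    rcases hx : topDigit (act y p) with _ | z
    · have hy : y = !s := by
        rcases topDigit_of_act_eq_none hx with h1 | h1 <;> rw [h1] at hw
        · simp at hw
        · simpa using hw.2
      right
      rw [if_pos ((hzero y p hp).2 hx), hw.1, hq, hy]
      simp [act]
    · left
      rw [if_neg (by rw [hzero y p hp, hx]; simp), ← hx,
        topDigit_act y p (by simp [hw.2]) (by simp [hx])]
      exact hw
  · obtain ⟨p, r, hp, ht, hd, ht', hd'⟩ := key w y
    rw [region, mem_ofPred_eq, ht', hd'] at hw
    rw [eq_root_iff hm.le, region, mem_ofPred_eq, ht, hd]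
    -- The prefix is nonzero after the step, so nothing was carried and the tails agree.
    rw [if_neg (by rw [hzero y p hp, hw.2]; simp)] at hw
    rcases hx : topDigit p with _ | z
    · exact Or.inr ⟨hw.1, rfl⟩
    · refine Or.inl ⟨hw.1, ?_⟩
      rw [← hx, ← topDigit_act y p (by simp [hx]) (by simp [hw.2]), hw.2]

theorem proj_mem_region (h : n ≤ m) {w : Coset (m + 1)} (hw : w ∈ region x n d (m + 1)) :
    w.proj ∈ region x n d m := by
  obtain ⟨h1, h2⟩ := hw
  refine ⟨?_, ?_⟩
  · rw [code_proj, List.drop_take, h1, ← List.drop_take, x.take_code (Nat.le_succ m)]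
  · rw [code_proj, List.take_take, min_eq_left h, h2]

/-- The digits of `x` from the `n`-th on, for a flip at `n`, determine the most significant
nonzero one of more than `n` digits. -/
theorem FlipsAt.mem_region (h : FlipsAt x n s) (h' : FlipsAt x l s') (hnl : n < l) (hlm : l < m)
    {w : Coset m} (hw : (code w).drop n = (code (x.1 m)).drop n) : w ∈ region x l (!s') m := by
  obtain ⟨q, hq⟩ := h.drop_code hnl
  have hdl : ∀ y : List Digit, y.drop l = (y.drop n).drop (l - n) := fun y => by
    rw [List.drop_drop, Nat.add_sub_cancel' hnl.le]
  have htl : ((code w).take l).drop n = some s :: q := by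
    rw [List.drop_take, hw, ← List.drop_take, x.take_code hlm.le, hq]
  have htop : ∀ y : List Digit, y.drop n = some s :: q →
      topDigit y = topDigit (some s :: q) := fun y hy => by
    rw [← List.take_append_drop n y, topDigit_append, hy]
    rcases hx : topDigit q <;> simp [topDigit, hx]
  refine ⟨by rw [hdl, hw, ← hdl], ?_⟩
  rw [htop _ htl, ← htop _ hq, h'.topDigit_code]

/-! ### Topology of the lobes. -/

/-- The part of the leaf cut off by the root at level `n`. -/
def lobe (x : VertexSeq) (n : ℕ) (d : Bool) : Set (Leaf (vertexPt x)) :=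
  {p | ∀ m, n < m → p.val.1 m ∈ star (region x n d m)}

/-- The vertices of a leaf. -/
def leafVertex (x : VertexSeq) (g : F₂) : Leaf (vertexPt x) :=
  ⟨vertexPt (x.mul g), joined_vertexPt_mul x g⟩

/-- The edges of a leaf. -/
def leafEdge (x : VertexSeq) (g : F₂) (s : Bool) (t : unitInterval) : Leaf (vertexPt x) :=
  ⟨edgePt (x.mul g) s t, (joined_vertexPt_mul x g).trans (joined_edgePt _ s t)⟩

theorem continuous_leafEdge (x : VertexSeq) (g : F₂) (s : Bool) :
    Continuous (leafEdge x g s) :=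
  continuous_to_leaf (continuous_edgePt _ s)

/-- The root at level `n` as a point of the leaf. -/
def rootPt (x : VertexSeq) (n : ℕ) : Leaf (vertexPt x) := leafVertex x (tau (code (x.1 n)))⁻¹

theorem continuous_leaf_coord (x : VertexSeq) (m : ℕ) :
    Continuous fun p : Leaf (vertexPt x) => p.val.1 m :=
  (continuous_coord m).comp continuous_leaf_val

theorem FlipsAt.rootPt_notMem (h : FlipsAt x n s) : rootPt x n ∉ lobe x n (!s) := fun hmem =>
  (h.isCut (Nat.lt_succ_self n)).notMem (vertex_mem_star.1 (hmem _ (Nat.lt_succ_self n)))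

theorem coord_mem_star_of_le (hnl : n ≤ l) (hlm : l ≤ m) {p : Continuum}
    (hp : p.1 m ∈ star (region x n d m)) : p.1 l ∈ star (region x n d l) := by
  induction m, hlm using Nat.le_induction with
  | base => exact hp
  | succ m hlm ih =>
    refine ih ?_
    rw [← p.2]
    exact bond_mem_star (fun w hw => proj_mem_region (hnl.trans hlm) hw) hp

/-- A lobe is given by infinitely many conditions, but a path satisfying the one at level `n + 1`
cannot cross the root at a higher level, because that root projects to the root at level `n + 1`. So
the path keeps all the conditions that hold at its start. -/
theorem FlipsAt.isOpen_lobe (h : FlipsAt x n s) : IsOpen (lobe x n (!s)) := by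
  have hO : IsOpen {p : Continuum | p.1 (n + 1) ∈ star (region x n (!s) (n + 1))} :=
    (isOpen_star _).preimage (continuous_coord (n + 1))
  refine isOpen_iff_mem_nhds.2 fun p hp => ?_
  have hpO := hp _ (Nat.lt_succ_self n)
  refine mem_of_superset ((isOpen_preimage_pathComponentIn hO hpO).mem_nhds
    (mem_pathComponentIn_self hpO)) fun q ⟨γ, hγ⟩ m hm => ?_
  have hcont : Continuous fun t => (γ t).1 m := (continuous_coord m).comp γ.continuous
  refine (h.isCut hm).subset_star (isPreconnected_range hcont) ?_ ⟨p.val.1 m, ⟨0, ?_⟩, hp m hm⟩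
    ⟨1, ?_⟩
  · rintro ⟨t, ht⟩
    have h1 := hγ t
    rw [mem_ofPred_eq, vertexPt_coord_of_le (show n + 1 ≤ m from hm) ht] at h1
    exact (h.isCut (Nat.lt_succ_self n)).notMem h1
  · simp only [γ.source]
  · simp only [γ.target]

theorem FlipsAt.closure_lobe_subset (h : FlipsAt x n s) :
    closure (lobe x n (!s)) ⊆ lobe x n (!s) ∪ {rootPt x n} := by
  intro p hp
  have hclosed : ∀ m, n < m →
      p.val.1 m ∈ star (region x n (!s) m) ∪ {vertex ((root x n).1 m)} := fun m hm =>
    closure_minimal (s := lobe x n (!s)) (fun q (hq : q ∈ lobe x n (!s)) => Or.inl (hq m hm))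
      ((h.isCut hm).isClosed_union.preimage (continuous_leaf_coord x m)) hp
  by_cases hall : ∀ m, n < m → p.val.1 m ∈ star (region x n (!s) m)
  · exact Or.inl hall
  · push Not at hall
    obtain ⟨m, hm, hnot⟩ := hall
    refine Or.inr (Leaf.val_injective (Subtype.ext (funext fun j => ?_)))
    -- Star membership passes down to lower levels, so failure at `m` persists above it. The closed
    -- condition then leaves only the root.
    have hbig : ∀ j, m ≤ j → p.val.1 j = vertex ((root x n).1 j) := fun j hj =>
      (hclosed j (hm.trans_le hj)).resolve_left fun h1 =>
        hnot (coord_mem_star_of_le hm.le hj h1)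
    exact vertexPt_coord_of_le (le_max_right m j) (hbig _ (le_max_left m j))

/-- All digits of `y` from the `n`-th on are those of `x`, so only finitely many such vertices
exist, one for each word of length `n`. This gives compactness of the closed lobe. -/
theorem eq_root_mul {y : VertexSeq}
    (hy : ∀ m, n < m → y.1 m ∈ region x n d m ∨ y.1 m = (root x n).1 m) :
    y = x.mul ((tau (code (x.1 n)))⁻¹ * tau (code (y.1 n))) := by
  refine VertexSeq.ext_of_lt n fun m hm => code_injective m ?_
  have hdrop : (code (y.1 m)).drop n = (code (x.1 m)).drop n :=
    (hy m hm).elim (fun h1 => h1.1) fun h1 => ((eq_root_iff hm.le).1 h1).1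
  have h2 := ract_tau (code (y.1 n)) ((code (x.1 m)).drop n)
  rw [length_code] at h2
  rw [← VertexSeq.mul_mul, VertexSeq.code_mul, ← root, code_root hm.le, h2, ← hdrop,
    ← y.take_code hm.le, List.take_append_drop]

theorem FlipsAt.isCompact_closure_lobe (h : FlipsAt x n s) :
    IsCompact (closure (lobe x n (!s))) := by
  have hcomp : IsCompact (⋃ l ∈ {l : List Digit | l.length = n}, ⋃ s' : Bool,
      range (leafEdge x ((tau (code (x.1 n)))⁻¹ * tau l) s')) :=
    (List.finite_length_eq Digit n).isCompact_biUnion fun l _ => isCompact_iUnion fun s' =>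
      isCompact_range (continuous_leafEdge _ _ _)
  refine hcomp.of_isClosed_subset isClosed_closure (h.closure_lobe_subset.trans fun p hp => ?_)
  obtain ⟨y, s', t, hp', hy⟩ : ∃ y s' t, p.val = edgePt y s' t ∧
      ∀ m, n < m → y.1 m ∈ region x n (!s) m ∨ y.1 m = (root x n).1 m := by
    rcases hp with hp | rfl
    · rcases vertexPt_or_edgePt p.val with ⟨y, hy⟩ | ⟨y, s', t, h0, h1, hy⟩
      · refine ⟨y, true, 0, by rw [hy, edgePt_zero], fun m hm => Or.inl ?_⟩
        have := hp m hm
        rwa [hy] at this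
      · refine ⟨y, s', t, hy, fun m hm => ?_⟩
        have := hp m hm
        rw [hy] at this
        exact ((edge_mem_star h0 h1).1 this).elim Or.inl ((h.isCut hm).of_step _ _)
    · exact ⟨root x n, true, 0, (edgePt_zero _ _).symm, fun m _ => Or.inr rfl⟩
  refine mem_iUnion₂.2 ⟨code (y.1 n), length_code _, mem_iUnion.2 ⟨s', t, ?_⟩⟩
  refine Leaf.val_injective ?_
  rw [hp']
  exact congrArg (fun z => edgePt z s' t) (eq_root_mul hy).symm

/-- Digit `n` of `x` is nonzero, so the top digit among the first `l` does not depend on the digits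
below `n`, the only ones that vary in the smaller lobe and its root. -/
theorem FlipsAt.lobe_union_subset (h : FlipsAt x n s) (h' : FlipsAt x l s') (hnl : n < l) :
    lobe x n (!s) ∪ {rootPt x n} ⊆ lobe x l (!s') := by
  rintro p (hp | rfl) m hm
  · exact star_mono (fun w hw => h.mem_region h' hnl hm hw.1) (hp m (hnl.trans hm))
  · exact h.mem_region h' hnl hm ((eq_root_iff (hnl.trans hm).le).1 rfl).1

/-- A preconnected set that meets a lobe and is not contained in it contains the root. -/
theorem FlipsAt.rootPt_mem (h : FlipsAt x n s) {Q : Set (Leaf (vertexPt x))}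
    (hQ : IsPreconnected Q) (hne : (Q ∩ lobe x n (!s)).Nonempty) (hnot : ¬ Q ⊆ lobe x n (!s)) :
    rootPt x n ∈ Q := by
  by_contra hroot
  refine hnot (hQ.subset_left_of_subset_union h.isOpen_lobe isClosed_closure.isOpen_compl
    (disjoint_left.2 fun q hq hq' => hq' (subset_closure hq)) (fun q hq => ?_) hne)
  by_cases hqc : q ∈ closure (lobe x n (!s))
  · refine Or.inl ((h.closure_lobe_subset hqc).resolve_right ?_)
    rintro rfl
    exact hroot hq
  · exact Or.inr hqc

/-- The union is open and nonempty in a connected leaf. It is closed because the lobes cannot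
accumulate at a point: their successive roots are distinct vertices, and small connected sets
contain at most one vertex. -/
theorem iUnion_lobe (N : ℕ → ℕ) (S : ℕ → Bool) (hN : StrictMono N)
    (hflip : ∀ i, FlipsAt x (N i) (S i)) : ⋃ i, lobe x (N i) (!S i) = univ := by
  have hsucc : ∀ i, lobe x (N i) (!S i) ∪ {rootPt x (N i)} ⊆ lobe x (N (i + 1)) (!S (i + 1)) :=
    fun i => (hflip i).lobe_union_subset (hflip (i + 1)) (hN (Nat.lt_succ_self i))
  have hopen : IsOpen (⋃ i, lobe x (N i) (!S i)) :=
    isOpen_iUnion fun i => (hflip i).isOpen_lobe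
  have hclosed : IsClosed (⋃ i, lobe x (N i) (!S i)) := by
    refine isClosed_of_closure_subset fun p hp => ?_
    obtain ⟨O, hO, hpO, huniq⟩ := exists_isOpen_subsingleton_vertices p.val
    have hself : p.val ∈ pathComponentIn O p.val := mem_pathComponentIn_self hpO
    have hQ := isPreconnected_preimage_pathComponentIn O p
    obtain ⟨q, hqQ, hq⟩ :=
      mem_closure_iff.1 hp _ (isOpen_preimage_pathComponentIn hO hpO) hself
    obtain ⟨i, hi⟩ := mem_iUnion.1 hq
    -- If `p` missed lobe `i + 1`, the small connected piece joining it to lobe `i` would contain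
    -- both roots `i` and `i + 1`. Those differ, since the first lies in lobe `i + 1` and the second
    -- does not.
    refine mem_iUnion.2 ⟨i + 1, ?_⟩
    by_contra hnot
    have h1 : rootPt x (N i) ∈ Leaf.val ⁻¹' pathComponentIn O p.val :=
      (hflip i).rootPt_mem hQ ⟨q, hqQ, hi⟩ fun hsub =>
        hnot (hsucc i (Or.inl (hsub hself)))
    have h2 : rootPt x (N (i + 1)) ∈ Leaf.val ⁻¹' pathComponentIn O p.val :=
      (hflip (i + 1)).rootPt_mem hQ ⟨q, hqQ, hsucc i (Or.inl hi)⟩ fun hsub => hnot (hsub hself)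
    have h3 := huniq _ pathComponentIn_subset (isPathConnected_pathComponentIn
      hpO).isConnected.isPreconnected _ _ h1 h2
    refine (hflip (i + 1)).rootPt_notMem (hsucc i (Or.inr ?_))
    exact Leaf.val_injective h3.symm
  refine IsClopen.eq_univ ⟨hclosed, hopen⟩ ⟨rootPt x (N 0), mem_iUnion.2 ⟨1, ?_⟩⟩
  exact hsucc 0 (Or.inr rfl)

theorem hasNumEnds_leaf (hx : ∀ k, ∃ n ≥ k, ∃ s, FlipsAt x n s) :
    HasNumEnds (Leaf (vertexPt x)) 1 := by
  obtain ⟨N, hN, hflip⟩ := extraction_of_frequently_atTop (frequently_atTop.2 hx)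
  choose S hS using hflip
  refine hasNumEnds_one_of_frontier_subset (fun i => lobe x (N i) (!S i))
    (fun i => rootPt x (N i)) (fun i => (hS i).isOpen_lobe)
    (fun i => (hS i).isCompact_closure_lobe) (fun i => ?_) (iUnion_lobe N S hN hS) (fun i => ?_)
    (fun i => (hS i).rootPt_notMem)
  · exact (hS i).closure_lobe_subset.trans
      ((hS i).lobe_union_subset (hS (i + 1)) (hN (Nat.lt_succ_self i)))
  · intro p hp
    rw [(hS i).isOpen_lobe.frontier_eq] at hp
    exact ((hS i).closure_lobe_subset hp.1).resolve_left hp.2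

end Schori

theorem lemma3p5 (v : Schori.Continuum) (hv : Schori.IsVertex v)
    (hff : Schori.IsFlipFlopping v) : HasNumEnds (Schori.Leaf v) 1 := by
  obtain ⟨x, rfl⟩ := Schori.exists_vertexPt hv
  obtain ⟨I, hI, -, hside⟩ := hff
  refine Schori.hasNumEnds_leaf fun k => ?_
  -- A side component of level `n + 1` gives a flip at `n`, so asking for `m ≥ k + 1` makes `n ≥ k`.
  obtain ⟨m, hmI, hkm⟩ := hI (k + 1)
  obtain ⟨n, rfl⟩ := Nat.exists_eq_succ_of_ne_zero (show m ≠ 0 by omega)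
  refine ⟨n, by omega, ?_⟩
  rcases hside _ hmI with h | h
  · exact ⟨true, Schori.code_of_mem_side h⟩
  · exact ⟨false, Schori.code_of_mem_side h⟩
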